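/- For points $a,b,c$ of the plane let $\mathcal T(a,b,c)=\operatorname{sgn}\big((b-a)^{\perp}\cdot(c-b)\big)$, where $(x_0,x_1)^\perp=(-x_1,x_0)$; so $\mathcal T(a,b,c)=1$ iff $c$ is strictly to the left of the directed line from $a$ to $b$. For $a\ne b$ let $\mathcal L(a,b)$ be the line through $a$ and $b$, and let $\mathrm{LHP}(a,b)=\{c:\mathcal T(a,b,c)\ge 0\}$ and $\mathrm{RHP}(a,b)=\mathrm{LHP}(b,a)$ be its closed left and right half-planes. A tangent of a polygon $P$ is a line that meets $P$ and has $P$ in one of its two closed half-planes. An outer common tangent of two polygons is a tangent of both such that both polygons are on the same side of it. Let $P_0$ and $P_1$ be simple polygons with $n_0\ge3$ and $n_1\ge 3$ corners. The corners $p_0[0],\dots,p_0[n_0-1]$ of $P_0$ are given in counterclockwise order, and the corners $p_1[0],\dots,p_1[n_1-1]$ of $P_1$ in clockwise order, as read-only arrays; indices of corners of $P_k$ are taken modulo $n_k$. Assume general position: $P_0$ and $P_1$ have no common corner, and no three of the corners of $P_0$ and $P_1$ together are collinear. Assume that the convex hulls of $P_0$ and $P_1$ are disjoint. Consider the following algorithm.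 $\texttt{OuterCommonTangent}(P_0,P_1)$: 1. $s_0\gets0$; $t_0\gets1$; $s_1\gets0$; $t_1\gets1$; $u\gets0$. 2. While $t_0<2n_0$ or $t_1<2n_1$, do: if $\mathcal T(p_0[s_0],p_1[s_1],p_u[t_u])=1$, then set $s_u\gets t_u$ and $t_{1-u}\gets s_{1-u}+1$; after that (in either case) set $t_u\gets t_u+1$ and $u\gets 1-u$. 3. Return $(s_0,s_1)$. Then the algorithm terminates and returns indices $(s_0,s_1)$ such that $\mathcal L(p_0[s_0],p_1[s_1])$ is an outer common tangent of $P_0$ and $P_1$, with $P_0$ and $P_1$ both contained in $\mathrm{RHP}(p_0[s_0],p_1[s_1])$. It performs at most $4(n_0+n_1)$ iterations of the loop. It runs in linear time and constant workspace: there is an absolute constant $C$ such that, counting each arithmetic operation, comparison, memory access and assignment as one step, it takes at most $C(n_0+n_1)$ steps, and at any time it uses at most $C\log_2(n_0+n_1)$ bits for integers and holds at most $C$ real numbers. -/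

import Mathlib

/-! ### Plane geometry -/

/-- The plane. -/
abbrev Plane : Type := ℝ × ℝ

/-- The dot product. -/
def dot (x y : Plane) : ℝ := x.1 * y.1 + x.2 * y.2

/-- Counterclockwise rotation by a right angle. -/
def perp (x : Plane) : Plane := (-x.2, x.1)

/-- The orientation sign `T(a,b,c)`: `1`, `0` or `-1` when `c` is to the left of, on, or to the
right of the directed line from `a` to `b`. -/
noncomputable def orientSign (a b c : Plane) : SignType :=
  SignType.sign (dot (perp (b - a)) (c - b))

/-- The closed half-plane to the left of the directed line from `a` to `b` (for `a ≠ b`). -/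
def LHP (a b : Plane) : Set Plane := {c | 0 ≤ orientSign a b c}

/-- The closed half-plane to the right of the directed line from `a` to `b` (for `a ≠ b`). -/
def RHP (a b : Plane) : Set Plane := LHP b a

/-- `ℓ` is a line that meets `S` and has `S` in one of its two closed half-planes. (Exchanging
`a` and `b` exchanges the half-planes.) -/
def IsTangent (ℓ : AffineSubspace ℝ Plane) (S : Set Plane) : Prop :=
  ((ℓ : Set Plane) ∩ S).Nonempty ∧ ∃ a b : Plane, a ≠ b ∧ ℓ = line[ℝ, a, b] ∧ S ⊆ LHP a b

/-- `ℓ` is a tangent of both sets, and both are on the same side of `ℓ`. -/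
def IsOuterCommonTangent (ℓ : AffineSubspace ℝ Plane) (S₀ S₁ : Set Plane) : Prop :=
  IsTangent ℓ S₀ ∧ IsTangent ℓ S₁ ∧
    ∃ a b : Plane, a ≠ b ∧ ℓ = line[ℝ, a, b] ∧ S₀ ⊆ LHP a b ∧ S₁ ⊆ LHP a b

/-- A simple polygon: at least three corners, which are distinct; two consecutive edges share
exactly their common corner, and two other distinct edges are disjoint.
(`finRotate n i` is the cyclic successor of the index `i`.) -/
structure SimplePolygon where
  n : ℕ
  three_le : 3 ≤ n
  poly : Polygon Plane n
  injective : Function.Injective poly.vertices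
  adjacent : ∀ i : Fin n,
    poly.edgeSet ℝ i ∩ poly.edgeSet ℝ (finRotate n i) = {poly (finRotate n i)}
  nonadjacent : ∀ i j : Fin n, i ≠ j → finRotate n i ≠ j → finRotate n j ≠ i →
    Disjoint (poly.edgeSet ℝ i) (poly.edgeSet ℝ j)

namespace SimplePolygon

/-- The corner with index `i`, indices being taken modulo the number of corners. -/
def corner (P : SimplePolygon) (i : ℕ) : Plane :=
  P.poly ⟨i % P.n, Nat.mod_lt _ (lt_of_lt_of_le (by norm_num) P.three_le)⟩

/-- The polygon as a set of points: the closed polygonal curve formed by its edges. -/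
def carrier (P : SimplePolygon) : Set Plane := P.poly.boundary ℝ

/-- The convex hull of the polygon. -/
def hull (P : SimplePolygon) : Set Plane := convexHull ℝ P.carrier

/-- The corners are listed in counterclockwise order: the polygon turns left at a corner
of its convex hull. -/
def IsCounterclockwise (P : SimplePolygon) : Prop :=
  ∃ i : ℕ, P.corner (i + 1) ∈ P.hull.extremePoints ℝ ∧
    orientSign (P.corner i) (P.corner (i + 1)) (P.corner (i + 2)) = 1

/-- The corners are listed in clockwise order: the polygon turns right at a corner
of its convex hull. -/
def IsClockwise (P : SimplePolygon) : Prop :=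
  ∃ i : ℕ, P.corner (i + 1) ∈ P.hull.extremePoints ℝ ∧
    orientSign (P.corner i) (P.corner (i + 1)) (P.corner (i + 2)) = -1

end SimplePolygon

/-- No common corners, and no three collinear points among the corners of both polygons. -/
def GeneralPosition (P : Fin 2 → SimplePolygon) : Prop :=
  Disjoint (Set.range (P 0).corner) (Set.range (P 1).corner) ∧
    ∀ a ∈ ⋃ k, Set.range (P k).corner, ∀ b ∈ ⋃ k, Set.range (P k).corner,
      ∀ c ∈ ⋃ k, Set.range (P k).corner, a ≠ b → b ≠ c → a ≠ c →
        ¬ Collinear ℝ ({a, b, c} : Set Plane)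

/-! ### The machine model

Programs over finitely many integer variables with read-only access to the two arrays of corners.
Every arithmetic operation, comparison, memory access and assignment takes one unit of time. -/

/-- The integer variables: `s k`, `t k` for `k = 0, 1`, and `u`. -/
inductive Var where
  | s (k : Fin 2)
  | t (k : Fin 2)
  | u
  deriving DecidableEq

/-- The contents of the variables. -/
abbrev Store : Type := Var → ℕ

/-- The number of bits needed to store all variables. -/
def Store.bits (σ : Store) : ℕ :=
  Nat.size (σ (.s 0)) + Nat.size (σ (.t 0)) + Nat.size (σ (.s 1)) + Nat.size (σ (.t 1)) +
    Nat.size (σ .u)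

/-- Integer expressions; `size k` is the number of corners of the `k`-th polygon. -/
inductive NatExp where
  | var (x : Var)
  | const (c : ℕ)
  | size (k : Fin 2)
  | add (e f : NatExp)
  | sub (e f : NatExp)
  | mul (e f : NatExp)

namespace NatExp

def eval (P : Fin 2 → SimplePolygon) (σ : Store) : NatExp → ℕ
  | var x => σ x
  | const c => c
  | size k => (P k).n
  | add e f => e.eval P σ + f.eval P σ
  | sub e f => e.eval P σ - f.eval P σ
  | mul e f => e.eval P σ * f.eval P σ

/-- The number of operations in the evaluation. -/
def cost : NatExp → ℕ
  | var _ => 1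
  | const _ => 1
  | size _ => 1
  | add e f => e.cost + f.cost + 1
  | sub e f => e.cost + f.cost + 1
  | mul e f => e.cost + f.cost + 1

/-- The number of bits of all intermediate values of the evaluation together. -/
def bits (P : Fin 2 → SimplePolygon) (σ : Store) : NatExp → ℕ
  | var x => Nat.size (σ x)
  | const c => Nat.size c
  | size k => Nat.size (P k).n
  | add e f => e.bits P σ + f.bits P σ + Nat.size ((add e f).eval P σ)
  | sub e f => e.bits P σ + f.bits P σ + Nat.size ((sub e f).eval P σ)
  | mul e f => e.bits P σ + f.bits P σ + Nat.size ((mul e f).eval P σ)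

end NatExp

/-- Real expressions; `xcoord k e` and `ycoord k e` read a coordinate of the corner of the `k`-th
polygon whose index is the value of `e`, modulo the number of corners. -/
inductive RealExp where
  | xcoord (k : Fin 2) (e : NatExp)
  | ycoord (k : Fin 2) (e : NatExp)
  | sub (a b : RealExp)
  | mul (a b : RealExp)

namespace RealExp

noncomputable def eval (P : Fin 2 → SimplePolygon) (σ : Store) : RealExp → ℝ
  | xcoord k e => ((P k).corner (e.eval P σ)).1
  | ycoord k e => ((P k).corner (e.eval P σ)).2
  | sub a b => a.eval P σ - b.eval P σ
  | mul a b => a.eval P σ * b.eval P σ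

/-- The number of operations in the evaluation; reading a coordinate takes a reduction of the
index modulo the number of corners and a memory access. -/
def cost : RealExp → ℕ
  | xcoord _ e => e.cost + 2
  | ycoord _ e => e.cost + 2
  | sub a b => a.cost + b.cost + 1
  | mul a b => a.cost + b.cost + 1

/-- The number of bits of all intermediate integers of the evaluation together. -/
def bits (P : Fin 2 → SimplePolygon) (σ : Store) : RealExp → ℕ
  | xcoord k e => e.bits P σ + Nat.size (e.eval P σ % (P k).n)
  | ycoord k e => e.bits P σ + Nat.size (e.eval P σ % (P k).n)
  | sub a b => a.bits P σ + b.bits P σ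
  | mul a b => a.bits P σ + b.bits P σ

/-- The number of intermediate real values of the evaluation. -/
def cells : RealExp → ℕ
  | xcoord _ _ => 1
  | ycoord _ _ => 1
  | sub a b => a.cells + b.cells + 1
  | mul a b => a.cells + b.cells + 1

/-- The expression `(b - a)^⊥ · (c - b)`, where `a`, `b`, `c` are given as a polygon and
an index. -/
def orient (a b c : Fin 2 × NatExp) : RealExp :=
  sub (mul (sub (xcoord b.1 b.2) (xcoord a.1 a.2)) (sub (ycoord c.1 c.2) (ycoord b.1 b.2)))
    (mul (sub (ycoord b.1 b.2) (ycoord a.1 a.2)) (sub (xcoord c.1 c.2) (xcoord b.1 b.2)))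

end RealExp

/-- Tests; `pos a` is the test `a > 0`. -/
inductive Test where
  | lt (e f : NatExp)
  | eq (e f : NatExp)
  | pos (a : RealExp)
  | or (p q : Test)

namespace Test

def Holds (P : Fin 2 → SimplePolygon) (σ : Store) : Test → Prop
  | lt e f => e.eval P σ < f.eval P σ
  | eq e f => e.eval P σ = f.eval P σ
  | pos a => 0 < a.eval P σ
  | or p q => p.Holds P σ ∨ q.Holds P σ

def cost : Test → ℕ
  | lt e f => e.cost + f.cost + 1
  | eq e f => e.cost + f.cost + 1
  | pos a => a.cost + 1
  | or p q => p.cost + q.cost + 1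

/-- The number of bits of all intermediate integers and truth values together. -/
def bits (P : Fin 2 → SimplePolygon) (σ : Store) : Test → ℕ
  | lt e f => e.bits P σ + f.bits P σ + 1
  | eq e f => e.bits P σ + f.bits P σ + 1
  | pos a => a.bits P σ + 1
  | or p q => p.bits P σ + q.bits P σ + 1

def cells : Test → ℕ
  | lt _ _ => 0
  | eq _ _ => 0
  | pos a => a.cells
  | or p q => p.cells + q.cells

end Test

/-- Programs. -/
inductive Cmd where
  | skip
  | assign (x : Var) (e : NatExp)
  | seq (c d : Cmd)
  | ite (p : Test) (c d : Cmd)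
  | while (p : Test) (c : Cmd)

/-- The resources used by a run: the time, the number of iterations of loops, the maximal number
of bits in use at any time (variables and intermediate values), and the maximal number of real
numbers in use at any time. -/
structure Usage where
  time : ℕ
  iterations : ℕ
  bits : ℕ
  cells : ℕ

/-- The resources of a run followed by another run. -/
def Usage.andThen (U V : Usage) : Usage where
  time := U.time + V.time
  iterations := U.iterations + V.iterations
  bits := max U.bits V.bits
  cells := max U.cells V.cells

/-- The resources of the evaluation of a test. -/
def Test.usage (P : Fin 2 → SimplePolygon) (σ : Store) (p : Test) : Usage where
  time := p.cost
  iterations := 0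
  bits := σ.bits + p.bits P σ
  cells := p.cells

/-- `Exec P c σ U σ'`: on the input `P`, the program `c` started with the variables `σ` halts with
the variables `σ'` and uses the resources `U`. -/
inductive Exec (P : Fin 2 → SimplePolygon) : Cmd → Store → Usage → Store → Prop
  | skip (σ : Store) : Exec P .skip σ ⟨0, 0, σ.bits, 0⟩ σ
  | assign (x : Var) (e : NatExp) (σ : Store) :
      Exec P (.assign x e) σ
        ⟨e.cost + 1, 0,
          max (σ.bits + e.bits P σ) (Store.bits (Function.update σ x (e.eval P σ))), 0⟩
        (Function.update σ x (e.eval P σ))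
  | seq {c d : Cmd} {σ σ' σ'' : Store} {U V : Usage} :
      Exec P c σ U σ' → Exec P d σ' V σ'' → Exec P (.seq c d) σ (U.andThen V) σ''
  | ite_true {p : Test} {c d : Cmd} {σ σ' : Store} {U : Usage} :
      p.Holds P σ → Exec P c σ U σ' → Exec P (.ite p c d) σ ((p.usage P σ).andThen U) σ'
  | ite_false {p : Test} {c d : Cmd} {σ σ' : Store} {U : Usage} :
      ¬ p.Holds P σ → Exec P d σ U σ' → Exec P (.ite p c d) σ ((p.usage P σ).andThen U) σ'
  | while_true {p : Test} {c : Cmd} {σ σ' σ'' : Store} {U V : Usage} :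
      p.Holds P σ → Exec P c σ U σ' → Exec P (.while p c) σ' V σ'' →
        Exec P (.while p c) σ
          (((p.usage P σ).andThen ⟨0, 1, 0, 0⟩).andThen (U.andThen V)) σ''
  | while_false {p : Test} {c : Cmd} {σ : Store} :
      ¬ p.Holds P σ → Exec P (.while p c) σ (p.usage P σ) σ

/-! ### The algorithm -/

/-- One iteration of the loop in the case `u = k`:
if `T(p₀[s₀], p₁[s₁], pₖ[tₖ]) = 1` then `sₖ ← tₖ` and `t₁₋ₖ ← s₁₋ₖ + 1`;
afterwards `tₖ ← tₖ + 1` and `u ← 1 - u`. -/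
def outerCommonTangentBody (k : Fin 2) : Cmd :=
  .seq
    (.ite (.pos (.orient (0, .var (.s 0)) (1, .var (.s 1)) (k, .var (.t k))))
      (.seq (.assign (.s k) (.var (.t k)))
        (.assign (.t (1 - k)) (.add (.var (.s (1 - k))) (.const 1))))
      .skip)
    (.seq (.assign (.t k) (.add (.var (.t k)) (.const 1)))
      (.assign .u (.sub (.const 1) (.var .u))))

/-- The algorithm `OuterCommonTangent`: after the initialization
`s₀ ← 0; t₀ ← 1; s₁ ← 0; t₁ ← 1; u ← 0`, loop while `t₀ < 2 n₀` or `t₁ < 2 n₁`.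
The result is the pair of the final values of `s₀` and `s₁`. -/
def outerCommonTangent : Cmd :=
  .seq (.assign (.s 0) (.const 0)) <|
  .seq (.assign (.t 0) (.const 1)) <|
  .seq (.assign (.s 1) (.const 0)) <|
  .seq (.assign (.t 1) (.const 1)) <|
  .seq (.assign .u (.const 0)) <|
  .while (.or (.lt (.var (.t 0)) (.mul (.const 2) (.size 0)))
      (.lt (.var (.t 1)) (.mul (.const 2) (.size 1))))
    (.ite (.eq (.var .u) (.const 0)) (outerCommonTangentBody 0) (outerCommonTangentBody 1))

/-! A line `dot φ = c` separates the two hulls. Among the lines through one corner of each polygon,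
the wanted tangent meets the separating line highest; it touches at corners `r₀ < n₀` and `r₁ < n₁`
(`exists_tangent`). Three facts then give correctness. First, `s k` never exceeds `r k + n k`.
Second, all corners strictly between `s k` and `t k` have been rejected for the current line. At the
end `t k ≥ 2 n k > r k + n k`, so neither touching corner is left of the final line. Third, a line
with neither touching corner on its left is at least as high as the tangent, hence is the tangent.

The heart is the first fact: the search on one polygon cannot jump over the second visit of its
touching corner `p r`. The topology of simple curves enters only through signed crossings of the
path from `p r` to `p w` with the segment from the current corner `p s` to the current corner `q` of
the other polygon. When the viewpoint moves along an edge that crosses no edge of the path, the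
change of this count depends only on the two ends of the path (`crossing_sub_crossing`, a finite
check on orientation signs). When the line turns about `p s`, the change depends only on which ends
are swept over (`crossing_turn`). The invariant `Unwound`, that no such count is positive, therefore
survives both kinds of update. If `r + n` were skipped, or reached with a corner left of the new
line, some `p w` would be left of the line to `q` from `p s` and also from `p r`. The left turn at
`p r` would make its count equal to 1, a contradiction (`not_left_of_unwound`).

The left turn at `p r` comes from the orientation hypothesis: a winding number has the same value at
all corners, and at a hull corner it depends only on the turn (`SeparatedPath.left_turn`). The
second polygon is treated by reflection.

For the iteration bound, `s 0 + s 1 + t 0 + t 1` grows in every iteration, because alternation keeps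
`t 0 - s 0` and `t 1 - s 1` within one of each other. -/

/-! ### Orientation of triples -/

/-- The doubled signed area of the triangle `a`, `b`, `c`. -/
def orient (a b c : Plane) : ℝ := (b.1 - a.1) * (c.2 - b.2) - (b.2 - a.2) * (c.1 - b.1)

lemma orient_cycle (a b c : Plane) : orient b c a = orient a b c := by
  simp only [orient]; ring

lemma orient_swap (a b c : Plane) : orient a c b = -orient a b c := by
  simp only [orient]; ring

lemma orient_rev (a b c : Plane) : orient c b a = -orient a b c := by
  simp only [orient]; ring

lemma orient_swap_left (a b c : Plane) : orient b a c = -orient a b c := by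
  simp only [orient]; ring

@[simp] lemma orient_self_left (a b : Plane) : orient a b a = 0 := by
  simp only [orient]; ring

@[simp] lemma orient_self_right (a b : Plane) : orient a b b = 0 := by
  simp only [orient]; ring

/-- A linear functional evaluated along the linear dependency of three vectors. -/
lemma dot_plucker (g o a b c : Plane) :
    (dot g a - dot g o) * orient o b c + (dot g b - dot g o) * orient o c a +
      (dot g c - dot g o) * orient o a b = 0 := by
  simp only [orient, dot]; ring

/-! ### Signed crossings -/

open Classical in
/-- `1` if `a` is to the left of the directed line from `b` to `q`, and `0` otherwise. -/
noncomputable def leftOf (q b a : Plane) : ℤ := if 0 < orient b q a then 1 else 0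

open Classical in
/-- The signed number of crossings of the edge from `a` to `b` with the segment from `s` to `q`,
where crossings from right to left count positively. The point `q` is supposed to lie beyond
the edge. -/
noncomputable def crossing (q s a b : Plane) : ℤ :=
  if ¬ 0 < orient s q a ∧ 0 < orient s q b ∧ 0 < orient a b s then 1
  else if 0 < orient s q a ∧ ¬ 0 < orient s q b ∧ ¬ 0 < orient a b s then -1
  else 0

/-- The change of the number of crossings seen from `b` when `b` moves to `b'`, as a function
of the end of the crossing path. -/
noncomputable def crossingJump (q b b' a : Plane) : ℤ :=
  leftOf q b' a - leftOf q b a + crossing q a b b'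

/-- The edges from `a` to `a'` and from `b` to `b'` cross. -/
def Cross (a a' b b' : Plane) : Prop :=
  orient a a' b * orient a a' b' < 0 ∧ orient b b' a * orient b b' a' < 0

/-- `leftOf` in terms of signs. -/
def leftOfSign (x : Bool) : ℤ := if x then 1 else 0

/-- `crossing` in terms of signs. -/
def crossingSign (x y z : Bool) : ℤ :=
  if !x && y && z then 1 else if x && !y && !z then -1 else 0

open Classical in
lemma leftOf_eq (q b a : Plane) : leftOf q b a = leftOfSign (decide (0 < orient b q a)) := by
  simp [leftOf, leftOfSign]

open Classical in
lemma crossing_eq (q s a b : Plane) : crossing q s a b =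
    crossingSign (decide (0 < orient s q a)) (decide (0 < orient s q b))
      (decide (0 < orient a b s)) := by
  simp [crossing, crossingSign, and_assoc]

/-- `false` if three sums with vanishing total have the same sign. -/
def signsCompatible (a b c d e f : Bool) : Bool :=
  !((a == b) && (c == d) && (e == f)) && !((a != b) && (c != d) && (e != f))

open Classical in
-- Three nonzero numbers of equal sign cannot cancel. This turns the three-term determinant
-- relations into constraints on signs, so that the geometric case analyses become finite checks.
lemma signsCompatible_of_sum_eq_zero {a b c d e f : ℝ} (ha : a ≠ 0) (hb : b ≠ 0) (hc : c ≠ 0)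
    (hd : d ≠ 0) (he : e ≠ 0) (hf : f ≠ 0) (h : a * b + c * d + e * f = 0) :
    signsCompatible (decide (0 < a)) (decide (0 < b)) (decide (0 < c)) (decide (0 < d))
      (decide (0 < e)) (decide (0 < f)) = true := by
  have key : ∀ x y : ℝ, x ≠ 0 → y ≠ 0 →
      ((decide (0 < x) == decide (0 < y)) = true ∧ 0 < x * y) ∨
      ((decide (0 < x) == decide (0 < y)) = false ∧ x * y < 0) := by
    intro x y hx hy
    rcases lt_or_gt_of_ne hx with hx | hx <;> rcases lt_or_gt_of_ne hy with hy | hy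
    · left; simp [hx.not_gt, hy.not_gt]; nlinarith
    · right; simp [hx.not_gt, hy]; nlinarith
    · right; simp [hx, hy.not_gt]; nlinarith
    · left; simp [hx, hy]
  unfold signsCompatible
  rcases key a b ha hb with ⟨h1, h1'⟩ | ⟨h1, h1'⟩ <;>
  rcases key c d hc hd with ⟨h2, h2'⟩ | ⟨h2, h2'⟩ <;>
  rcases key e f he hf with ⟨h3, h3'⟩ | ⟨h3, h3'⟩ <;>
  first
  | (exfalso; linarith)
  | simp [bne, h1, h2, h3]

open Classical in
lemma decide_pos_neg {x : ℝ} (h : x ≠ 0) : decide (0 < -x) = !decide (0 < x) := by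
  rcases lt_or_gt_of_ne h with h | h
  · simp [h, h.not_gt]
  · simp [h, h.le]

set_option synthInstance.maxSize 100000 in
set_option synthInstance.maxHeartbeats 1000000 in
set_option maxRecDepth 100000 in
-- The finite core of `crossing_sub_crossing`. The `x` are the sides of `a`, `a'` seen from `b`,
-- `b'`, the `y` compare the ends of each edge, and the `z` are the orientations among the four
-- ends. The hypotheses are transitivity of the order by direction from `q`, one determinant
-- relation for each of the four points as pivot, and that the edges do not cross.
lemma crossingSign_pair : ∀ x₁ x₂ x₃ x₄ y₁ y₂ z₁ z₂ z₃ z₄ : Bool,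
    ((y₁ == x₁) && (x₁ == !x₂)) = false → ((y₁ == x₃) && (x₃ == !x₄)) = false →
    ((y₂ == !x₁) && ((!x₁) == x₃)) = false → ((y₂ == !x₂) && ((!x₂) == x₄)) = false →
    signsCompatible z₁ x₃ (!y₁) z₃ (!z₂) x₁ = true →
    signsCompatible (!z₁) x₄ y₁ z₄ z₂ x₂ = true →
    signsCompatible z₃ (!x₂) (!y₂) z₁ z₄ x₁ = true →
    signsCompatible z₃ x₄ y₂ z₂ (!z₄) x₃ = true →
    ((z₁ != z₂) && (z₃ != z₄)) = false →
    crossingSign x₃ x₄ z₂ - crossingSign x₁ x₂ z₁ =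
      (leftOfSign x₄ - leftOfSign x₂ + crossingSign (!x₂) (!x₄) z₄) -
        (leftOfSign x₃ - leftOfSign x₁ + crossingSign (!x₁) (!x₃) z₃) := by
  decide

open Classical in
/-- Points on one side of a line are linearly ordered by their direction from a point `q` beyond
the line. -/
lemma orient_not_cyclic {g q a b c : Plane} (ha : dot g a < dot g q) (hb : dot g b < dot g q)
    (hc : dot g c < dot g q) (h₁ : orient a q b ≠ 0) (h₂ : orient c q a ≠ 0)
    (h₃ : orient c q b ≠ 0) :
    ((decide (0 < orient a q b) == decide (0 < orient c q a)) &&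
      (decide (0 < orient c q a) == !decide (0 < orient c q b))) = false := by
  have h := dot_plucker g q a b c
  rw [show orient q b c = orient c q b from orient_cycle _ _ _,
    show orient q c a = -orient c q a by simp only [orient]; ring,
    show orient q a b = - orient a q b by simp only [orient]; ring] at h
  rcases lt_or_gt_of_ne h₁ with k₁ | k₁ <;> rcases lt_or_gt_of_ne h₂ with k₂ | k₂ <;>
    rcases lt_or_gt_of_ne h₃ with k₃ | k₃ <;>
    simp [k₁, k₁.not_gt, k₂, k₂.not_gt, k₃, k₃.not_gt] <;>
    nlinarith [mul_pos_of_neg_of_neg (sub_neg.2 ha) (sub_neg.2 hb)]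

/-- If two edges do not cross, then the change of the crossing of the edge from `a` to `a'` with
the segment from `b` to `q`, when `b` moves along the edge to `b'`, only depends on the ends. -/
lemma crossing_sub_crossing {g q a a' b b' : Plane} (ha : dot g a < dot g q)
    (ha' : dot g a' < dot g q) (hb : dot g b < dot g q) (hb' : dot g b' < dot g q)
    (h₁ : orient b q a ≠ 0) (h₂ : orient b q a' ≠ 0) (h₃ : orient b' q a ≠ 0)
    (h₄ : orient b' q a' ≠ 0) (h₅ : orient a q a' ≠ 0) (h₆ : orient b q b' ≠ 0)
    (k₁ : orient a a' b ≠ 0) (k₂ : orient a a' b' ≠ 0) (k₃ : orient b b' a ≠ 0)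
    (k₄ : orient b b' a' ≠ 0) (hc : ¬ Cross a a' b b') :
    crossing q b' a a' - crossing q b a a' =
      crossingJump q b b' a' - crossingJump q b b' a := by
  classical
  have e₁ : orient a q b = - orient b q a := orient_rev _ _ _
  have e₂ : orient a' q b = - orient b q a' := orient_rev _ _ _
  have e₃ : orient a q b' = - orient b' q a := orient_rev _ _ _
  have e₄ : orient a' q b' = - orient b' q a' := orient_rev _ _ _
  simp only [crossingJump, crossing_eq, leftOf_eq, e₁, e₂, e₃, e₄, decide_pos_neg h₁,
    decide_pos_neg h₂, decide_pos_neg h₃, decide_pos_neg h₄]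
  have n₁ := orient_not_cyclic ha ha' hb h₅ h₁ h₂
  have n₂ := orient_not_cyclic ha ha' hb' h₅ h₃ h₄
  have n₃ := orient_not_cyclic hb hb' ha h₆ (by rwa [e₁, neg_ne_zero]) (by rwa [e₃, neg_ne_zero])
  have n₄ := orient_not_cyclic hb hb' ha' h₆ (by rwa [e₂, neg_ne_zero]) (by rwa [e₄, neg_ne_zero])
  rw [e₁, e₃, decide_pos_neg h₁, decide_pos_neg h₃, Bool.not_not] at n₃
  rw [e₂, e₄, decide_pos_neg h₂, decide_pos_neg h₄, Bool.not_not] at n₄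
  have g₁ := signsCompatible_of_sum_eq_zero k₁ h₃ (neg_ne_zero.2 h₅) k₃ (neg_ne_zero.2 k₂) h₁
    (by simp only [orient]; ring)
  have g₂ := signsCompatible_of_sum_eq_zero (neg_ne_zero.2 k₁) h₄ h₅ k₄ k₂ h₂
    (by simp only [orient]; ring)
  have g₃ := signsCompatible_of_sum_eq_zero k₃ (neg_ne_zero.2 h₂) (neg_ne_zero.2 h₆) k₁ k₄ h₁
    (by simp only [orient]; ring)
  have g₄ := signsCompatible_of_sum_eq_zero k₃ h₄ h₆ k₂ (neg_ne_zero.2 k₄) h₃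
    (by simp only [orient]; ring)
  simp only [decide_pos_neg h₂, decide_pos_neg h₅, decide_pos_neg h₆, decide_pos_neg k₁,
    decide_pos_neg k₂, decide_pos_neg k₄] at g₁ g₂ g₃ g₄
  refine crossingSign_pair _ _ _ _ _ _ _ _ _ _ n₁ n₂ n₃ n₄ g₁ g₂ g₃ g₄ ?_
  by_contra hne
  refine hc ?_
  have aux : ∀ {x y : ℝ}, x ≠ 0 → y ≠ 0 → decide (0 < x) ≠ decide (0 < y) → x * y < 0 := by
    intro x y hx hy h
    rcases lt_or_gt_of_ne hx with hx | hx <;> rcases lt_or_gt_of_ne hy with hy | hy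
    · simp [hx.not_gt, hy.not_gt] at h
    · exact mul_neg_of_neg_of_pos hx hy
    · exact mul_neg_of_pos_of_neg hx hy
    · simp [hx, hy] at h
  simp only [Bool.not_eq_false, Bool.and_eq_true, bne_iff_ne] at hne
  exact ⟨aux k₁ k₂ hne.1, aux k₃ k₄ hne.2⟩

lemma leftOf_symm {q a b : Plane} (h : orient b q a ≠ 0) : leftOf q a b = 1 - leftOf q b a := by
  unfold leftOf
  rw [orient_rev b q a]
  rcases lt_or_gt_of_ne h with h | h
  · simp [h, h.not_gt]
  · simp [h, h.le]

lemma leftOf_of_pos {q a b : Plane} (h : 0 < orient b q a) : leftOf q b a = 1 := if_pos h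

lemma leftOf_of_nonpos {q a b : Plane} (h : orient b q a ≤ 0) : leftOf q b a = 0 :=
  if_neg h.not_gt

lemma crossing_of_nonpos {q s a b : Plane} (ha : orient s q a ≤ 0) (hb : orient s q b ≤ 0) :
    crossing q s a b = 0 := by
  simp [crossing, ha.not_gt, hb.not_gt]

lemma crossing_of_nonpos_right {q s a b : Plane} (hb : orient s q b ≤ 0) :
    crossing q s a b ≤ 0 := by
  unfold crossing
  simp only [hb.not_gt, false_and, and_false, if_false]
  split_ifs <;> simp

lemma crossing_le_one (q s a b : Plane) : crossing q s a b ≤ 1 := by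
  unfold crossing
  split_ifs <;> simp

/-- Seen from a vertex `r` of the convex hull, all crossings with the line through `r` and `q` are
on the side of `q`. -/
lemma crossing_hull {g q r a b : Plane} (ha : dot g a < dot g r) (hb : dot g b < dot g r)
    (hq : dot g q ≤ dot g r) (h₁ : orient r q a ≠ 0) (h₂ : orient r q b ≠ 0) :
    crossing q r a b = leftOf q r b - leftOf q r a := by
  have h := dot_plucker g r a b q
  rw [show orient r b q = -orient r q b from orient_swap _ _ _,
    show orient r a b = orient a b r from (orient_cycle _ _ _).symm] at h
  unfold crossing leftOf
  rcases lt_or_gt_of_ne h₁ with k₁ | k₁ <;> rcases lt_or_gt_of_ne h₂ with k₂ | k₂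
  · simp [k₁.not_gt, k₂.not_gt]
  · have : 0 < orient a b r := by
      by_contra hn
      nlinarith [mul_pos_of_neg_of_neg (sub_neg.2 hb) k₁,
        mul_pos_of_neg_of_neg (sub_neg.2 ha) (neg_lt_zero.2 k₂),
        mul_nonneg_of_nonpos_of_nonpos (sub_nonpos.2 hq) (not_lt.1 hn)]
    simp [k₁.not_gt, k₂, this]
  · have : ¬ 0 < orient a b r := by
      intro hn
      nlinarith [mul_neg_of_neg_of_pos (sub_neg.2 hb) k₁,
        mul_neg_of_neg_of_pos (sub_neg.2 ha) (neg_pos.2 k₂),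
        mul_nonneg (sub_nonneg.2 hq) hn.le]
    simp [k₁, k₂.not_gt, this]
  · simp [k₁, k₂]

/-- From a vertex `r` of the convex hull, a point `q` beyond `r` is visible. -/
lemma crossing_visible {g q r a b : Plane} (ha : dot g a < dot g r) (hb : dot g b < dot g r)
    (hq : dot g r ≤ dot g q) (h₁ : orient r q a ≠ 0) (h₂ : orient r q b ≠ 0) :
    crossing q r a b = 0 := by
  have h := dot_plucker g r a b q
  rw [show orient r b q = -orient r q b from orient_swap _ _ _,
    show orient r a b = orient a b r from (orient_cycle _ _ _).symm] at h
  unfold crossing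
  rcases lt_or_gt_of_ne h₁ with k₁ | k₁ <;> rcases lt_or_gt_of_ne h₂ with k₂ | k₂
  · simp [k₁.not_gt, k₂.not_gt]
  · have : ¬ 0 < orient a b r := by
      intro hn
      nlinarith [mul_pos_of_neg_of_neg (sub_neg.2 hb) k₁,
        mul_pos_of_neg_of_neg (sub_neg.2 ha) (neg_lt_zero.2 k₂),
        mul_nonneg (sub_nonneg.2 hq) hn.le]
    simp [k₁.not_gt, this]
  · have : 0 < orient a b r := by
      by_contra hn
      nlinarith [mul_neg_of_neg_of_pos (sub_neg.2 hb) k₁,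
        mul_neg_of_neg_of_pos (sub_neg.2 ha) (neg_pos.2 k₂),
        mul_nonneg (sub_nonneg.2 hq) (neg_nonneg.2 (not_lt.1 hn))]
    simp [k₂.not_gt, this]
  · simp [k₁, k₂]

/-- Crossings seen from `r` telescope, which cancels the change of `leftOf`. Hence the starting
corner `p r` of the counted path contributes nothing when the viewpoint moves. -/
lemma crossingJump_hull {g q r a b : Plane} (ha : dot g a < dot g r) (hb : dot g b < dot g r)
    (hq : dot g q ≤ dot g r) (h₁ : orient r q a ≠ 0) (h₂ : orient r q b ≠ 0) :
    crossingJump q a b r = 0 := by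
  rw [crossingJump, crossing_hull ha hb hq h₁ h₂, leftOf_symm h₁, leftOf_symm h₂]
  ring

/-! ### Turning the line about a corner -/

open Classical in
/-- `1` for points to the left of the line from `s` to `q`, but not of the line from `s` to `q'`. -/
noncomputable def wedge (s q q' v : Plane) : ℤ :=
  if 0 < orient s q v ∧ ¬ 0 < orient s q' v then 1 else 0

lemma wedge_nonneg (s q q' v : Plane) : 0 ≤ wedge s q q' v := by
  unfold wedge; split_ifs <;> simp

lemma crossingSign_turn : ∀ x x' y y' z : Bool,
    signsCompatible true z (!x) y' y x' = true →
    crossingSign x y z - crossingSign x' y' z =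
      (if y && !y' then 1 else 0) - (if x && !x' then 1 else 0) := by
  decide

/-- Since `q'` is to the left of the line from `s` to `q`, the wedge is the cone at `s` between the
two rays. A positive crossing of the first ray enters it and a positive crossing of the second
leaves it, so the difference counts net entries. -/
lemma crossing_turn {s q q' a b : Plane} (hq : 0 < orient s q q') (h₁ : orient s q a ≠ 0)
    (h₂ : orient s q b ≠ 0) (h₃ : orient s q' a ≠ 0) (h₄ : orient s q' b ≠ 0)
    (h₅ : orient a b s ≠ 0) :
    crossing q s a b - crossing q' s a b = wedge s q q' b - wedge s q q' a := by
  classical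
  have h := signsCompatible_of_sum_eq_zero hq.ne' h₅ (neg_ne_zero.2 h₁) h₄ h₂ h₃
    (by simp only [orient]; ring)
  rw [decide_pos_neg h₁, decide_eq_true hq] at h
  have := crossingSign_turn _ _ _ _ _ h
  simp only [crossing_eq, this, wedge]
  simp

/-- A vertex at which a common tangent touches is never swept over by the line. -/
lemma wedge_hull {φ g s q q' r : Plane} {c : ℝ} (hs : dot φ s < c) (hr : dot φ r < c)
    (hq : c < dot φ q) (hq' : c < dot φ q') (gs : dot g s < dot g r) (gq : dot g q ≤ dot g r)
    (gq' : dot g q' ≤ dot g r) (h : 0 < orient s q q') (h' : orient s q' r ≠ 0) :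
    wedge s q q' r = 0 := by
  unfold wedge
  rw [if_neg]
  rintro ⟨h₁, h₂⟩
  have h₂ : orient s q' r < 0 := lt_of_le_of_ne (not_lt.1 h₂) h'
  have e₁ := dot_plucker φ s q q' r
  have e₂ := dot_plucker g s q q' r
  rw [show orient s r q = - orient s q r from orient_swap _ _ _] at e₁ e₂
  set A := orient s q q'
  set B := orient s q r
  set D := orient s q' r
  -- With `r - s = α (q - s) + β (q' - s)`, this says `α + β < 1`: otherwise `r` would lie beyond
  -- the separating line. So `r` is a convex combination of `s`, `q`, `q'` with positive weight on
  -- `s`, which `g` forbids.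
  have k : B - D < A := by
    by_contra hn
    nlinarith [mul_pos (sub_pos.2 hq) (neg_pos.2 h₂), mul_pos (sub_pos.2 hq') h₁,
      mul_pos (sub_pos.2 hr) h, mul_nonneg (sub_nonneg.2 (not_lt.1 hn)) (sub_pos.2 hs).le]
  nlinarith [mul_nonneg (sub_nonneg.2 gq) (neg_pos.2 h₂).le, mul_nonneg (sub_nonneg.2 gq') h₁.le,
    mul_pos (sub_pos.2 k) (sub_pos.2 gs)]

/-! ### Left turns -/

/-- With `r` extreme for `g`, a left turn from `b` through `r` to `v` leaves two sign patterns that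
would violate the identity. One is excluded by `φ`, since `q` lies beyond the three corners, and the
other by `g`. This supplies the single positive crossing in `not_left_of_unwound`. -/
lemma crossing_left_turn {φ g q b r v : Plane} (gb : dot g b < dot g r) (gv : dot g v < dot g r)
    (gq : dot g q ≤ dot g r) (pb : dot φ b < dot φ q) (pr : dot φ r < dot φ q)
    (pv : dot φ v < dot φ q) (h₁ : orient b q r ≠ 0) (h₂ : orient b q v ≠ 0)
    (h₃ : orient v q r ≠ 0) (h : 0 < orient b r v) :
    crossing q b r v - leftOf q b v + crossing q v b r = 0 := by
  have e₁ : orient r v b = orient b r v := orient_cycle _ _ _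
  have e₂ : orient v q b = - orient b q v := orient_rev _ _ _
  have f₁ := dot_plucker g r b v q
  have f₂ := dot_plucker φ q r b v
  rw [show orient r v q = orient v q r by simp only [orient]; ring,
    show orient r q b = -orient b q r by simp only [orient]; ring,
    show orient r b v = -orient b r v by simp only [orient]; ring] at f₁
  rw [show orient q b v = -orient b q v by simp only [orient]; ring,
    show orient q v r = - orient v q r by simp only [orient]; ring,
    show orient q r b = orient b q r by simp only [orient]; ring] at f₂
  unfold crossing leftOf
  rw [e₁, e₂]
  rcases lt_or_gt_of_ne h₂ with k₂ | k₂
  · simp [h, k₂, k₂.not_gt]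
  · rcases lt_or_gt_of_ne h₁ with k₁ | k₁ <;> rcases lt_or_gt_of_ne h₃ with k₃ | k₃
    · simp [h, k₁.not_gt, k₂, k₂.le, k₃.not_gt]
    · exfalso
      nlinarith [mul_pos (sub_pos.2 pr) k₂, mul_pos (sub_pos.2 pb) k₃,
        mul_pos (sub_pos.2 pv) (neg_pos.2 k₁)]
    · exfalso
      nlinarith [mul_pos (sub_pos.2 gb) (neg_pos.2 k₃), mul_pos (sub_pos.2 gv) k₁,
        mul_nonneg (sub_nonneg.2 gq) h.le]
    · simp [h, k₁, k₂, k₂.le, k₃]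

/-- The contribution of the corner `y` between `x` and `z` to the winding number. -/
noncomputable def turnTerm (q x y z : Plane) : ℤ :=
  leftOf q z x - leftOf q y x - leftOf q z y + crossing q x y z + crossing q z x y

lemma turnTerm_visible_sign : ∀ a b c k : Bool, ((a == b) && (b == !c)) = false →
    (a && b && k) = false → (!a && !b && !k) = false →
    leftOfSign c - leftOfSign a - leftOfSign b + crossingSign (!a) (!c) k + crossingSign c b k =
      if k then 0 else -1 := by
  decide

lemma turnTerm_hidden_sign : ∀ a b c k : Bool, ((a == b) && (b == !c)) = false →
    (a && b && !k) = false → (!a && !b && k) = false →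
    leftOfSign a - (1 - leftOfSign b) + (leftOfSign c - leftOfSign a - leftOfSign b +
      crossingSign (!a) (!c) k + crossingSign c b k) = if k then 0 else -1 := by
  decide

open Classical in
lemma turn_not_cyclic {φ q x y z : Plane} (px : dot φ x < dot φ q) (py : dot φ y < dot φ q)
    (pz : dot φ z < dot φ q) (h₁ : orient y q x ≠ 0) (h₂ : orient z q y ≠ 0)
    (h₃ : orient z q x ≠ 0) :
    ((decide (0 < orient y q x) == decide (0 < orient z q y)) &&
    (decide (0 < orient z q y) == !decide (0 < orient z q x))) = false :=
  orient_not_cyclic py px pz h₁ h₂ h₃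

open Classical in
lemma turnTerm_visible {φ g q x y z : Plane} (gx : dot g x < dot g y) (gz : dot g z < dot g y)
    (px : dot φ x < dot φ q) (py : dot φ y < dot φ q) (pz : dot φ z < dot φ q)
    (h₁ : orient y q x ≠ 0) (h₂ : orient z q y ≠ 0) (h₃ : orient z q x ≠ 0)
    (gq : dot g y ≤ dot g q) :
    turnTerm q x y z = if 0 < orient x y z then 0 else -1 := by
  have e := dot_plucker g y x z q
  rw [show orient y z q = orient z q y from (orient_cycle _ _ _).symm,
    show orient y x z = -orient x y z from orient_swap_left _ _ _] at e
  have := turnTerm_visible_sign (decide (0 < orient y q x)) (decide (0 < orient z q y))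
    (decide (0 < orient z q x)) (decide (0 < orient x y z))
    (turn_not_cyclic px py pz h₁ h₂ h₃) ?_ ?_
  · simp only [turnTerm, leftOf_eq, crossing_eq, orient_rev y q x, orient_rev z q x,
      decide_pos_neg h₁, decide_pos_neg h₃, orient_cycle x y z]
    rw [this]
    simp
  · by_contra hn
    simp only [Bool.not_eq_false, Bool.and_eq_true, decide_eq_true_eq] at hn
    nlinarith [mul_pos (sub_pos.2 gx) hn.1.2, mul_pos (sub_pos.2 gz) hn.1.1,
      mul_nonneg (sub_nonneg.2 gq) hn.2.le]
  · by_contra hn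
    simp only [Bool.not_eq_false, Bool.and_eq_true, Bool.not_eq_true', decide_eq_false_iff_not,
      not_lt] at hn
    nlinarith [mul_pos (sub_pos.2 gx) (neg_pos.2 (lt_of_le_of_ne hn.1.2 h₂)),
      mul_pos (sub_pos.2 gz) (neg_pos.2 (lt_of_le_of_ne hn.1.1 h₁)),
        mul_nonneg (sub_nonneg.2 gq) (neg_nonneg.2 hn.2)]

open Classical in
lemma turnTerm_hidden {φ g q x y z : Plane} (gx : dot g x < dot g y) (gz : dot g z < dot g y)
    (px : dot φ x < dot φ q) (py : dot φ y < dot φ q) (pz : dot φ z < dot φ q)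
    (h₁ : orient y q x ≠ 0) (h₂ : orient z q y ≠ 0) (h₃ : orient z q x ≠ 0)
    (gq : dot g q ≤ dot g y) :
    leftOf q y x - leftOf q y z + turnTerm q x y z = if 0 < orient x y z then 0 else -1 := by
  have e := dot_plucker g y x z q
  rw [show orient y z q = orient z q y from (orient_cycle _ _ _).symm,
    show orient y x z = -orient x y z from orient_swap_left _ _ _] at e
  have := turnTerm_hidden_sign (decide (0 < orient y q x)) (decide (0 < orient z q y))
    (decide (0 < orient z q x)) (decide (0 < orient x y z))
    (turn_not_cyclic px py pz h₁ h₂ h₃) ?_ ?_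
  · rw [leftOf_symm h₂]
    simp only [turnTerm, leftOf_eq, crossing_eq, orient_rev y q x, orient_rev z q x,
      decide_pos_neg h₁, decide_pos_neg h₃, orient_cycle x y z]
    rw [this]
    simp
  · by_contra hn
    simp only [Bool.not_eq_false, Bool.and_eq_true, Bool.not_eq_true', decide_eq_false_iff_not,
      decide_eq_true_eq, not_lt] at hn
    nlinarith [mul_pos (sub_pos.2 gx) hn.1.2, mul_pos (sub_pos.2 gz) hn.1.1,
      mul_nonneg (sub_nonneg.2 gq) (neg_nonneg.2 hn.2)]
  · by_contra hn
    simp only [Bool.not_eq_false, Bool.and_eq_true, Bool.not_eq_true', decide_eq_false_iff_not,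
      decide_eq_true_eq, not_lt] at hn
    nlinarith [mul_pos (sub_pos.2 gx) (neg_pos.2 (lt_of_le_of_ne hn.1.2 h₂)),
      mul_pos (sub_pos.2 gz) (neg_pos.2 (lt_of_le_of_ne hn.1.1 h₁)),
        mul_nonneg (sub_nonneg.2 gq) hn.2.le]

/-! ### Closed polygonal paths -/

/-- The signed number of crossings of the path `p lo, …, p (lo + len)` with the segment from `b`
to `q`. -/
noncomputable def crossings (q b : Plane) (p : ℕ → Plane) (lo len : ℕ) : ℤ :=
  ∑ j ∈ Finset.range len, crossing q b (p (lo + j)) (p (lo + j + 1))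

lemma crossings_succ (q b : Plane) (p : ℕ → Plane) (lo len : ℕ) :
    crossings q b p lo (len + 1) =
      crossings q b p lo len + crossing q b (p (lo + len)) (p (lo + len + 1)) :=
  Finset.sum_range_succ _ _

lemma crossings_succ' (q b : Plane) (p : ℕ → Plane) (lo len : ℕ) :
    crossings q b p lo (len + 1) =
      crossing q b (p lo) (p (lo + 1)) + crossings q b p (lo + 1) len := by
  rw [crossings, Finset.sum_range_succ', add_comm]
  simp only [crossings, add_zero, add_assoc, add_comm 1]

lemma crossings_eq_sub {q b : Plane} {p : ℕ → Plane} {lo len : ℕ} (f : Plane → ℤ)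
    (h : ∀ j < len, crossing q b (p (lo + j)) (p (lo + j + 1)) =
      f (p (lo + j + 1)) - f (p (lo + j))) :
    crossings q b p lo len = f (p (lo + len)) - f (p lo) := by
  induction len with
  | zero => simp [crossings]
  | succ m ih =>
    rw [crossings_succ, ih fun j hj => h j (hj.trans m.lt_succ_self), h m m.lt_succ_self]
    rw [add_assoc]
    ring

lemma crossings_eq_zero {q b : Plane} {p : ℕ → Plane} {lo len : ℕ}
    (h : ∀ j < len, crossing q b (p (lo + j)) (p (lo + j + 1)) = 0) :
    crossings q b p lo len = 0 :=
  Finset.sum_eq_zero fun j hj => h j (Finset.mem_range.1 hj)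

lemma not_modEq_of_lt {n i j : ℕ} (h : i < j) (h' : j < i + n) : ¬ i ≡ j [MOD n] := by
  intro hm
  have := (Nat.modEq_iff_dvd' h.le).1 hm
  have := Nat.le_of_dvd (by omega) this
  omega

/-- A simple closed path `p` with `n` corners in general position, separated by a line from a set
`Q` of points. -/
structure SeparatedPath (p : ℕ → Plane) (n : ℕ) (Q : Set Plane) (φ : Plane) (c : ℝ) : Prop where
  three_le : 3 ≤ n
  periodic : ∀ i, p (i + n) = p i
  generic : ∀ i j k, ¬ i ≡ j [MOD n] → ¬ j ≡ k [MOD n] → ¬ i ≡ k [MOD n] →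
    orient (p i) (p j) (p k) ≠ 0
  generic_right : ∀ q ∈ Q, ∀ i j, ¬ i ≡ j [MOD n] → orient (p i) q (p j) ≠ 0
  not_cross : ∀ i j, ¬ i ≡ j [MOD n] → ¬ i + 1 ≡ j [MOD n] → ¬ j + 1 ≡ i [MOD n] →
    ¬ Cross (p i) (p (i + 1)) (p j) (p (j + 1))
  left : ∀ i, dot φ (p i) < c
  right : ∀ q ∈ Q, c < dot φ q

namespace SeparatedPath

variable {p : ℕ → Plane} {n : ℕ} {Q : Set Plane} {φ : Plane} {c : ℝ}

lemma dot_lt (C : SeparatedPath p n Q φ c) {q : Plane} (hq : q ∈ Q) (i : ℕ) :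
    dot φ (p i) < dot φ q :=
  (C.left i).trans (C.right q hq)

lemma generic_right_lt (C : SeparatedPath p n Q φ c) {q : Plane} (hq : q ∈ Q) {i j : ℕ}
    (h : i < j) (h' : j < i + n) : orient (p i) q (p j) ≠ 0 :=
  C.generic_right q hq i j (not_modEq_of_lt h h')

lemma generic_right_gt (C : SeparatedPath p n Q φ c) {q : Plane} (hq : q ∈ Q) {i j : ℕ}
    (h : i < j) (h' : j < i + n) : orient (p j) q (p i) ≠ 0 :=
  C.generic_right q hq j i fun e => not_modEq_of_lt h h' e.symm

lemma generic_lt (C : SeparatedPath p n Q φ c) {i j k : ℕ} (h₁ : i < j) (h₂ : j < k)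
    (h₃ : k < i + n) : orient (p i) (p j) (p k) ≠ 0 :=
  C.generic i j k (not_modEq_of_lt h₁ (by omega)) (not_modEq_of_lt h₂ (by omega))
    (not_modEq_of_lt (h₁.trans h₂) h₃)

/-- The change of the number of crossings of a path with the segment from a corner to `q` when
the corner moves along an edge. -/
lemma crossings_sub (C : SeparatedPath p n Q φ c) {q : Plane} (hq : q ∈ Q) {lo len k : ℕ}
    (h₁ : lo + len < k) (h₂ : k + 1 < lo + n) :
    crossings q (p (k + 1)) p lo len - crossings q (p k) p lo len =
      crossingJump q (p k) (p (k + 1)) (p (lo + len)) -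
        crossingJump q (p k) (p (k + 1)) (p lo) := by
  induction len with
  | zero => simp [crossings]
  | succ m ih =>
    have ih := ih (by omega)
    have := crossing_sub_crossing (C.dot_lt hq (lo + m)) (C.dot_lt hq (lo + m + 1))
      (C.dot_lt hq k) (C.dot_lt hq (k + 1)) (C.generic_right_gt hq (by omega) (by omega))
      (C.generic_right_gt hq (by omega) (by omega)) (C.generic_right_gt hq (by omega) (by omega))
      (C.generic_right_gt hq (by omega) (by omega)) (C.generic_right_lt hq (by omega) (by omega))
      (C.generic_right_lt hq (by omega) (by omega)) (C.generic_lt (by omega) (by omega) (by omega))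
      (C.generic_lt (by omega) (by omega) (by omega))
      (by rw [orient_cycle]; exact C.generic_lt (by omega) (by omega) (by omega))
      (by rw [orient_cycle]; exact C.generic_lt (by omega) (by omega) (by omega))
      (C.not_cross _ _ (not_modEq_of_lt (by omega) (by omega))
        (not_modEq_of_lt (by omega) (by omega))
        fun e => not_modEq_of_lt (by omega) (by omega) e.symm)
    rw [crossings_succ, crossings_succ, ← add_assoc]
    linarith

/-! ### The winding number at a corner -/

/-- The winding number of the path on its left side at the corner `p i`, up to a constant. -/
noncomputable def winding (p : ℕ → Plane) (n : ℕ) (q : Plane) (i : ℕ) : ℤ :=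
  crossings q (p i) p (i + 1) (n - 2) + turnTerm q (p (i + n - 1)) (p i) (p (i + 1))

lemma winding_succ (C : SeparatedPath p n Q φ c) {q : Plane} (hq : q ∈ Q) (i : ℕ) :
    winding p n q (i + 1) = winding p n q i := by
  obtain ⟨m, rfl⟩ : ∃ m, n = m + 3 := ⟨n - 3, by have := C.three_le; omega⟩
  -- The two sums share the path from `p (i + 2)` to `p (i + n - 1)`. The viewpoint `p i` is written
  -- as `p (i + n)` so that its edge lies after that path within one period; the end terms are
  -- absorbed by `turnTerm`.
  have h := C.crossings_sub hq (lo := i + 2) (len := m) (k := i + (m + 3)) (by omega) (by omega)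
  have e : i + (m + 3) + 1 = (i + 1) + (m + 3) := by ring
  rw [e, C.periodic, C.periodic] at h
  unfold winding
  have e₁ : m + 3 - 2 = m + 1 := by omega
  rw [e₁, crossings_succ, crossings_succ',
    show i + 1 + 1 = i + 2 from rfl, show i + 2 + m + 1 = i + (m + 3) by ring,
    show i + 1 + (m + 3) - 1 = i + (m + 3) by omega,
    show i + (m + 3) - 1 = i + 2 + m by omega, C.periodic]
  have g₁ : orient (p i) q (p (i + 1)) ≠ 0 := C.generic_right_lt hq (by omega) (by omega)
  have g₂ : orient (p (i + 1)) q (p (i + 2)) ≠ 0 := C.generic_right_lt hq (by omega) (by omega)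
  have g₃ : orient (p i) q (p (i + 2)) ≠ 0 := C.generic_right_lt hq (by omega) (by omega)
  simp only [turnTerm, crossingJump] at h ⊢
  have s₁ := leftOf_symm g₁
  have s₂ := leftOf_symm g₂
  have s₃ := leftOf_symm g₃
  linarith

lemma winding_eq (C : SeparatedPath p n Q φ c) {q : Plane} (hq : q ∈ Q) (i j : ℕ) :
    winding p n q i = winding p n q j := by
  have : ∀ i, winding p n q i = winding p n q 0 := by
    intro i
    induction i with
    | zero => rfl
    | succ k ih => rw [C.winding_succ hq, ih]
  rw [this i, this j]

open Classical in
-- If `q` is beyond the supporting line at `p i`, the segment to `q` meets no edge of the rest of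
-- the path. If not, all crossings lie on the side of `q` and telescope. Either way only the turn at
-- `p i` is left.
lemma winding_extreme (C : SeparatedPath p n Q φ c) {q g : Plane} (hq : q ∈ Q) {i : ℕ}
    (hg : ∀ j, ¬ j ≡ i [MOD n] → dot g (p j) < dot g (p i)) :
    winding p n q i = if 0 < orient (p (i + n - 1)) (p i) (p (i + 1)) then 0 else -1 := by
  have h3 := C.three_le
  have hg' : ∀ j, i < j → j < i + n → dot g (p j) < dot g (p i) := fun j h h' =>
    hg j fun e => not_modEq_of_lt h h' e.symm
  have gx := hg' (i + n - 1) (by omega) (by omega)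
  have gz := hg' (i + 1) (by omega) (by omega)
  have h₁ : orient (p i) q (p (i + n - 1)) ≠ 0 := C.generic_right_lt hq (by omega) (by omega)
  have h₂ : orient (p (i + 1)) q (p i) ≠ 0 := C.generic_right_gt hq (by omega) (by omega)
  have h₃ : orient (p (i + 1)) q (p (i + n - 1)) ≠ 0 :=
    C.generic_right_lt hq (by omega) (by omega)
  rcases le_total (dot g (p i)) (dot g q) with hgq | hgq
  · rw [winding, crossings_eq_zero, zero_add]
    · exact turnTerm_visible gx gz (C.dot_lt hq _) (C.dot_lt hq _) (C.dot_lt hq _) h₁ h₂ h₃ hgq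
    · intro j hj
      exact crossing_visible (hg' _ (by omega) (by omega)) (hg' _ (by omega) (by omega)) hgq
        (C.generic_right_lt hq (by omega) (by omega)) (C.generic_right_lt hq (by omega) (by omega))
  · rw [winding, crossings_eq_sub (leftOf q (p i)), show i + 1 + (n - 2) = i + n - 1 by omega]
    · exact turnTerm_hidden gx gz (C.dot_lt hq _) (C.dot_lt hq _) (C.dot_lt hq _) h₁ h₂ h₃ hgq
    · intro j hj
      exact crossing_hull (hg' _ (by omega) (by omega)) (hg' _ (by omega) (by omega)) hgq
        (C.generic_right_lt hq (by omega) (by omega)) (C.generic_right_lt hq (by omega) (by omega))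

/-- If a simple closed path turns left at a vertex of its convex hull, then it does so at every
vertex of its convex hull. -/
lemma left_turn (C : SeparatedPath p n Q φ c) (hQ : Q.Nonempty) {g g' : Plane} {i r : ℕ}
    (hg : ∀ j, ¬ j ≡ i [MOD n] → dot g (p j) < dot g (p i))
    (hg' : ∀ j, ¬ j ≡ r [MOD n] → dot g' (p j) < dot g' (p r))
    (h : 0 < orient (p (i + n - 1)) (p i) (p (i + 1))) :
    0 < orient (p (r + n - 1)) (p r) (p (r + 1)) := by
  classical
  obtain ⟨q, hq⟩ := hQ
  have e := C.winding_eq hq i r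
  rw [C.winding_extreme hq hg, C.winding_extreme hq hg', if_pos h] at e
  by_contra hn
  simp [hn] at e

end SeparatedPath

/-! ### The search on one polygon -/

/-- All points lie strictly on one side of a line through `q`, so "to the left, seen towards `q`" is
a linear order. The proof writes one determinant as a positive combination of the other two. -/
lemma orient_pos_trans {φ q a b c : Plane} (ha : dot φ a < dot φ q) (hb : dot φ b < dot φ q)
    (hc : dot φ c < dot φ q) (h₁ : 0 ≤ orient a q b) (h₂ : 0 < orient b q c) :
    0 < orient a q c := by
  have h : (dot φ q - dot φ b) * orient a q c =
      (dot φ q - dot φ a) * orient b q c + (dot φ q - dot φ c) * orient a q b := by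
    simp only [orient, dot]; ring
  refine (mul_pos_iff_of_pos_left (sub_pos.2 hb)).1 ?_
  rw [h]
  exact add_pos_of_pos_of_nonneg (mul_pos (sub_pos.2 ha) h₂) (mul_nonneg (sub_pos.2 hc).le h₁)

/-- The corner `p r` is the only one on a line that has the path and `Q` on one side, and the path
turns left there. -/
structure TangentCorner (p : ℕ → Plane) (n : ℕ) (Q : Set Plane) (g : Plane) (r : ℕ) : Prop where
  lt : ∀ j, ¬ j ≡ r [MOD n] → dot g (p j) < dot g (p r)
  le : ∀ q ∈ Q, dot g q ≤ dot g (p r)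
  turn : 0 < orient (p (r + n - 1)) (p r) (p (r + 1))

/-- The path from `p r` to `p s` nowhere winds positively about `p s`, seen relative to the segment
from `p s` to `q`. -/
def Unwound (p : ℕ → Plane) (r : ℕ) (q : Plane) (s : ℕ) : Prop :=
  ∀ w, r ≤ w → w < s → crossings q (p s) p r (w - r) ≤ 0

/-- The states that the search on one polygon can reach: `p r` has not been passed, or it has been
passed once without winding, or it has been reached for the second time. -/
def Progress (p : ℕ → Plane) (n r : ℕ) (q : Plane) (s : ℕ) : Prop :=
  s < r ∨ (r ≤ s ∧ s < r + n ∧ Unwound p r q s) ∨ (s = r + n ∧ ∀ i, orient (p r) q (p i) ≤ 0)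

namespace SeparatedPath

variable {p : ℕ → Plane} {n r : ℕ} {Q : Set Plane} {φ g : Plane} {c : ℝ}

lemma tangent_lt (T : TangentCorner p n Q g r) {j : ℕ} (h : r < j) (h' : j < r + n) :
    dot g (p j) < dot g (p r) :=
  T.lt j fun e => not_modEq_of_lt h h' e.symm

/-- Rejected corners are right of the line from `p s`, so `p w` stays left of the line from every
viewpoint up to `p i`, and no traversed edge meets the segment from `p w` to `q`. The jump at `p w`
thus vanishes, as does the one at the extreme corner `p r`. -/
lemma crossings_advance_eq (C : SeparatedPath p n Q φ c) (T : TangentCorner p n Q g r) {q : Plane}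
    (hq : q ∈ Q) {s i w : ℕ} (hw : r ≤ w) (hws : w < s) (hsi : s ≤ i) (hi : i < r + n)
    (hrej : ∀ j, s < j → j ≤ i → orient (p s) q (p j) ≤ 0) (hpos : 0 < orient (p s) q (p w)) :
    crossings q (p i) p r (w - r) = crossings q (p s) p r (w - r) := by
  induction i, hsi using Nat.le_induction with
  | base => rfl
  | succ k hsk ih =>
    rw [← ih (by omega) fun j h h' => hrej j h (by omega)]
    have h := C.crossings_sub hq (lo := r) (len := w - r) (k := k) (by omega) (by omega)
    have hbelow : ∀ j, s ≤ j → j ≤ k + 1 → 0 < orient (p j) q (p w) := by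
      intro j hj hj'
      refine orient_pos_trans (C.dot_lt hq _) (C.dot_lt hq s) (C.dot_lt hq _) ?_ hpos
      rcases hj.eq_or_lt with rfl | hj
      · simp
      · rw [orient_rev]; linarith [hrej j hj hj']
    have h₁ := hbelow k hsk (by omega)
    have h₂ := hbelow (k + 1) (by omega) le_rfl
    have h₁' : orient (p w) q (p k) ≤ 0 := by rw [orient_rev]; linarith
    have h₂' : orient (p w) q (p (k + 1)) ≤ 0 := by rw [orient_rev]; linarith
    have hr : crossingJump q (p k) (p (k + 1)) (p r) = 0 :=
      crossingJump_hull (tangent_lt T (by omega) (by omega)) (tangent_lt T (by omega) (by omega))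
        (T.le q hq) (C.generic_right_lt hq (by omega) (by omega))
        (C.generic_right_lt hq (by omega) (by omega))
    rw [show r + (w - r) = w by omega, hr, crossingJump, leftOf_of_pos h₁, leftOf_of_pos h₂,
      crossing_of_nonpos h₁' h₂'] at h
    linarith

/-- If `p w` is left of the old line, only the move along the last edge can change the count, and
only downwards. If it is not, it is not left of the new line either, so the edge into `p w`
contributes at most 0 and induction on `w` applies. -/
lemma unwound_advance (C : SeparatedPath p n Q φ c) (T : TangentCorner p n Q g r) {q : Plane}
    (hq : q ∈ Q) {s t : ℕ} (hs : r ≤ s) (hst : s < t) (ht : t < r + n)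
    (hrej : ∀ j, s < j → j < t → orient (p s) q (p j) ≤ 0) (hpos : 0 < orient (p s) q (p t))
    (hU : Unwound p r q s) : Unwound p r q t := by
  have key : ∀ w, r ≤ w → w < s → 0 < orient (p s) q (p w) →
      crossings q (p t) p r (w - r) ≤ 0 := by
    intro w hw hws hwpos
    -- The count is constant up to the viewpoint `p k`; the edge into `p t` is treated separately.
    obtain ⟨k, rfl⟩ : ∃ k, t = k + 1 := ⟨t - 1, by omega⟩
    have e := C.crossings_advance_eq T hq (i := k) hw hws (by omega) (by omega)
      (fun j h h' => hrej j h (by omega)) hwpos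
    have h := C.crossings_sub hq (lo := r) (len := w - r) (k := k) (by omega) (by omega)
    have hr : crossingJump q (p k) (p (k + 1)) (p r) = 0 :=
      crossingJump_hull (tangent_lt T (by omega) (by omega)) (tangent_lt T (by omega) (by omega))
        (T.le q hq) (C.generic_right_lt hq (by omega) (by omega))
        (C.generic_right_lt hq (by omega) (by omega))
    have hk : 0 < orient (p k) q (p w) := by
      refine orient_pos_trans (C.dot_lt hq _) (C.dot_lt hq s) (C.dot_lt hq _) ?_ hwpos
      rcases (show s ≤ k by omega).eq_or_lt with rfl | hk
      · simp
      · rw [orient_rev]; linarith [hrej k hk (by omega)]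
    have hw' : crossingJump q (p k) (p (k + 1)) (p w) ≤ 0 := by
      rw [crossingJump, leftOf_of_pos hk]
      rcases lt_or_ge 0 (orient (p (k + 1)) q (p w)) with h' | h'
      · rw [leftOf_of_pos h', crossing_of_nonpos]
        · simp
        · rw [orient_rev]; linarith
        · rw [orient_rev]; linarith
      · rw [leftOf_of_nonpos h']
        linarith [crossing_le_one q (p w) (p k) (p (k + 1))]
    rw [show r + (w - r) = w by omega] at h
    linarith [hU w hw hws]
  intro w hw
  induction w, hw using Nat.le_induction with
  | base => intro _; simp [crossings]
  | succ w hw ih =>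
    intro hwt
    by_cases hc : w + 1 < s ∧ 0 < orient (p s) q (p (w + 1))
    · exact key _ (by omega) hc.1 hc.2
    · have hneg : orient (p s) q (p (w + 1)) ≤ 0 := by
        rcases lt_trichotomy (w + 1) s with h | h | h
        · by_contra hn
          exact hc ⟨h, not_le.1 hn⟩
        · rw [h]; simp
        · exact hrej _ h hwt
      have hneg' : orient (p t) q (p (w + 1)) ≤ 0 := by
        have := orient_pos_trans (C.dot_lt hq (w + 1)) (C.dot_lt hq s) (C.dot_lt hq t)
          (by rw [orient_rev]; linarith) hpos
        rw [orient_rev]; linarith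
      rw [show w + 1 - r = (w - r) + 1 by omega, crossings_succ,
        show r + (w - r) = w by omega]
      linarith [ih (by omega), crossing_of_nonpos_right (a := p w) hneg']

/-- Turning changes the count by the wedge terms of the ends of the path. The touching corner `p r`
is never swept over, and sweeping over `p w` can only lower the count. -/
lemma unwound_turn (C : SeparatedPath p n Q φ c) (T : TangentCorner p n Q g r) {q q' : Plane}
    (hq : q ∈ Q) (hq' : q' ∈ Q) {s : ℕ} (hs : s < r + n)
    (hpos : 0 < orient (p s) q q') (hU : Unwound p r q s) : Unwound p r q' s := by
  intro w hw hws
  have hsum : ∀ len, r + len < s → crossings q (p s) p r len - crossings q' (p s) p r len =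
      wedge (p s) q q' (p (r + len)) - wedge (p s) q q' (p r) := by
    intro len
    induction len with
    | zero => intro _; simp [crossings]
    | succ m ih =>
      intro hm
      have := crossing_turn hpos (a := p (r + m)) (b := p (r + m + 1))
        (C.generic_right_gt hq (by omega) (by omega)) (C.generic_right_gt hq (by omega) (by omega))
        (C.generic_right_gt hq' (by omega) (by omega))
        (C.generic_right_gt hq' (by omega) (by omega))
        (C.generic_lt (by omega) (by omega) (by omega))
      have ih := ih (by omega)
      rw [crossings_succ, crossings_succ, ← add_assoc]
      linarith
  have h := hsum (w - r) (by omega)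
  rw [wedge_hull (C.left s) (C.left r) (C.right q hq) (C.right q' hq')
    (tangent_lt T (by omega) hs) (T.le q hq) (T.le q' hq') hpos
    (C.generic_right_gt hq' (by omega) (by omega))] at h
  have := wedge_nonneg (p s) q q' (p (r + (w - r)))
  linarith [hU w hw hws]

/-- If the rest of the path up to the second visit of `p r` is not to the left of the line, then
neither are the earlier corners. -/
lemma not_left_of_unwound (C : SeparatedPath p n Q φ c) (T : TangentCorner p n Q g r) {q : Plane}
    (hq : q ∈ Q) {s w : ℕ} (hs : s < r + n)
    (hrej : ∀ j, s < j → j < r + n → orient (p s) q (p j) ≤ 0) (hU : Unwound p r q s)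
    (hw : r ≤ w) (hws : w < s) (h₁ : 0 < orient (p s) q (p w)) :
    orient (p r) q (p w) ≤ 0 := by
  by_contra! h₂
  have hrw : r < w := by
    rcases hw.eq_or_lt with rfl | h
    · simp at h₂
    · exact h
  -- The count seen from `p s` is the same at the last corner before `p r` is visited again.
  have e := C.crossings_advance_eq T hq (i := r + n - 1) hw hws (by omega) (by omega)
    (fun j h h' => hrej j h (by omega)) h₁
  obtain ⟨m, rfl⟩ : ∃ m, w = r + 1 + m := ⟨w - (r + 1), by omega⟩
  have hj := C.crossings_sub hq (lo := r + 1) (len := m) (k := r + n - 1) (by omega) (by omega)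
  have hr : crossings q (p r) p (r + 1) m =
      leftOf q (p r) (p (r + 1 + m)) - leftOf q (p r) (p (r + 1)) := by
    refine crossings_eq_sub (leftOf q (p r)) fun j hj => ?_
    exact crossing_hull (tangent_lt T (by omega) (by omega)) (tangent_lt T (by omega) (by omega))
      (T.le q hq) (C.generic_right_lt hq (by omega) (by omega))
      (C.generic_right_lt hq (by omega) (by omega))
  have hb : 0 < orient (p (r + n - 1)) q (p (r + 1 + m)) := by
    refine orient_pos_trans (C.dot_lt hq _) (C.dot_lt hq s) (C.dot_lt hq _) ?_ h₁
    rcases (show s ≤ r + n - 1 by omega).eq_or_lt with h | h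
    · rw [h]; simp
    · rw [orient_rev]; linarith [hrej _ h (by omega)]
  have ht := crossing_left_turn (tangent_lt T (j := r + n - 1) (by omega) (by omega))
    (tangent_lt T (j := r + 1) (by omega) (by omega)) (T.le q hq) (C.dot_lt hq _) (C.dot_lt hq _)
    (C.dot_lt hq _) (C.generic_right_gt hq (by omega) (by omega))
    (C.generic_right_gt hq (by omega) (by omega)) (C.generic_right_gt hq (by omega) (by omega))
    T.turn
  have hc : crossing q (p (r + 1 + m)) (p (r + n - 1)) (p r) = 0 := by
    apply crossing_of_nonpos
    · rw [orient_rev]; linarith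
    · rw [orient_rev]; linarith
  -- Moving on to `p r` evaluates the crossings of the path after its first edge, and the left turn
  -- evaluates that edge. Together they give the count 1, against `hU`.
  rw [show r + n - 1 + 1 = r + n by omega, C.periodic, hr, crossingJump, crossingJump,
    leftOf_of_pos hb, hc] at hj
  rw [show r + 1 + m - r = m + 1 by omega, crossings_succ'] at e
  have := hU _ hw hws
  rw [show r + 1 + m - r = m + 1 by omega] at this
  linarith

lemma progress_zero (p : ℕ → Plane) (hn : 0 < n) (q : Plane) : Progress p n r q 0 := by
  rcases Nat.eq_zero_or_pos r with rfl | h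
  · exact .inr (.inl ⟨le_rfl, by omega, fun w _ h => absurd h (Nat.not_lt_zero w)⟩)
  · exact .inl h

lemma progress_turn (C : SeparatedPath p n Q φ c) (T : TangentCorner p n Q g r) {q q' : Plane}
    (hq : q ∈ Q) (hq' : q' ∈ Q) {s : ℕ} (hpos : 0 < orient (p s) q q')
    (h : Progress p n r q s) : Progress p n r q' s := by
  rcases h with h | ⟨h, h', hU⟩ | ⟨rfl, h⟩
  · exact .inl h
  · exact .inr (.inl ⟨h, h', C.unwound_turn T hq hq' h' hpos hU⟩)
  · refine .inr (.inr ⟨rfl, fun i => ?_⟩)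
    rw [C.periodic] at hpos
    by_cases hi : i ≡ r [MOD n]
    · by_contra! hn
      have : p i = p r := by
        have hp : Function.Periodic p n := C.periodic
        rw [← hp.map_mod_nat i, ← hp.map_mod_nat r, hi]
      rw [this] at hn
      simp at hn
    -- The points `p i`, `q`, `q'` lie in the half-plane bounded by the supporting line at `p r`.
    -- Turning from `q` to the left within it cannot bring `p i` to the left.
    · have e := dot_plucker g (p r) (p i) q q'
      rw [orient_swap (p r) q (p i)] at e
      have := h i
      by_contra! hn
      nlinarith [mul_pos (sub_pos.2 (T.lt i hi)) hpos,
        mul_nonneg (sub_nonneg.2 (T.le q hq)) hn.le,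
        mul_nonneg (sub_nonneg.2 (T.le q' hq')) (neg_nonneg.2 this)]

/-- The first passage of `p r` creates no winding, since the corners just scanned are not left of
the new line. Once `p r` has been passed, `not_left_of_unwound` excludes overshooting `r + n` and
shows that landing there leaves no corner on the left. -/
lemma progress_advance (C : SeparatedPath p n Q φ c) (T : TangentCorner p n Q g r) {q : Plane}
    (hq : q ∈ Q) {s t : ℕ} (hst : s < t)
    (hrej : ∀ j, s < j → j < t → orient (p s) q (p j) ≤ 0) (hpos : 0 < orient (p s) q (p t))
    (h : Progress p n r q s) : Progress p n r q t := by
  have h3 := C.three_le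
  -- Otherwise the same corner, one period earlier, would already have been rejected for this line.
  have back : n ≤ t → t - n ≤ s := by
    intro hn
    by_contra! hlt
    have := hrej (t - n) hlt (by omega)
    rw [← C.periodic (t - n), Nat.sub_add_cancel hn] at this
    linarith
  rcases h with h | ⟨h, h', hU⟩ | ⟨rfl, h⟩
  · rcases lt_or_ge t r with ht | ht
    · exact .inl ht
    · refine .inr (.inl ⟨ht, ?_, ?_⟩)
      · by_contra! hn
        have := back (by omega)
        omega
      · have hneg : ∀ j, s ≤ j → j < t → orient (p t) q (p j) ≤ 0 := by
          intro j hj hjt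
          have := orient_pos_trans (C.dot_lt hq j) (C.dot_lt hq s) (C.dot_lt hq t) (by
            rcases hj.eq_or_lt with rfl | hj
            · simp
            · rw [orient_rev]; linarith [hrej j hj hjt]) hpos
          rw [orient_rev]; linarith
        intro w hw hwt
        refine (crossings_eq_zero fun j hj => ?_).le
        exact crossing_of_nonpos (hneg _ (by omega) (by omega)) (hneg _ (by omega) (by omega))
  · rcases lt_trichotomy t (r + n) with ht | rfl | ht
    · exact .inr (.inl ⟨by omega, ht, C.unwound_advance T hq h hst ht hrej hpos hU⟩)
    · refine .inr (.inr ⟨rfl, ?_⟩)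
      rw [C.periodic] at hpos
      have main : ∀ i, r ≤ i → i < r + n → orient (p r) q (p i) ≤ 0 := by
        intro i hi hi'
        have aux : orient (p s) q (p i) ≤ 0 → orient (p r) q (p i) ≤ 0 := by
          intro hn
          have := orient_pos_trans (C.dot_lt hq i) (C.dot_lt hq s) (C.dot_lt hq r)
            (by rw [orient_rev]; linarith) hpos
          rw [orient_rev]; linarith
        rcases lt_trichotomy i s with his | rfl | his
        · rcases le_or_gt (orient (p s) q (p i)) 0 with hn | hn
          · exact aux hn
          · exact C.not_left_of_unwound T hq h' hrej hU hi his hn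
        · exact aux (by simp)
        · exact aux (hrej i his hi')
      intro i
      have hp : Function.Periodic p n := C.periodic
      obtain ⟨j, hj, hj'⟩ : ∃ j, j ∈ Set.Ico r (r + n) ∧ p i = p j := by
        -- The summand `n * r - r` stands for `-r` modulo `n` and avoids truncated subtraction.
        refine ⟨r + (i + (n * r - r)) % n, ⟨by omega, by
          have := Nat.mod_lt (i + (n * r - r)) (show 0 < n by omega)
          omega⟩, ?_⟩
        rw [← hp.map_mod_nat i, ← hp.map_mod_nat (r + _), Nat.add_mod_mod]
        have : r ≤ n * r := Nat.le_mul_of_pos_left r (by omega)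
        rw [show r + (i + (n * r - r)) = i + n * r by omega, Nat.add_mul_mod_self_left]
      rw [hj']
      exact main j hj.1 hj.2
    -- Here `p (r + n)` was rejected while `p t = p (t - n)` is left of the line. By transitivity `p
    -- (t - n)` is also left of the line from `p r`, which the unwound path forbids.
    · exfalso
      have hts := back (by omega)
      have e : p t = p (t - n) := by rw [← C.periodic (t - n), Nat.sub_add_cancel (by omega)]
      rw [e] at hpos
      rcases hts.eq_or_lt with hts | hts
      · rw [hts] at hpos; simp at hpos
      · have hr := hrej (r + n) (by omega) ht
        rw [C.periodic] at hr
        have h₂ := C.not_left_of_unwound T hq h' (fun j h h' => hrej j h (by omega)) hU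
          (by omega) hts hpos
        have := orient_pos_trans (C.dot_lt hq r) (C.dot_lt hq s) (C.dot_lt hq (t - n))
            (by rw [orient_rev]; linarith) hpos
        linarith
  · rw [C.periodic] at hpos
    linarith [h t]

lemma Progress.le {q : Plane} {s : ℕ} (h : Progress p n r q s) : s ≤ r + n := by
  rcases h with h | ⟨_, h, _⟩ | ⟨h, _⟩ <;> omega

end SeparatedPath

/-! ### Simple polygons as closed paths -/

lemma orientSign_eq (a b c : Plane) : orientSign a b c = SignType.sign (orient a b c) := by
  unfold orientSign orient dot perp
  congr 1
  simp only [Prod.fst_sub, Prod.snd_sub]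
  ring

lemma mem_RHP_iff {a b c : Plane} : c ∈ RHP a b ↔ orient a b c ≤ 0 := by
  rw [RHP, LHP, Set.mem_ofPred_eq, orientSign_eq, sign_nonneg_iff, orient_swap_left]
  exact neg_nonneg

lemma collinear_of_orient_eq_zero {a b c : Plane} (hab : a ≠ b) (h : orient a b c = 0) :
    Collinear ℝ ({a, b, c} : Set Plane) := by
  rw [collinear_iff_of_mem (p₀ := a) (by simp)]
  refine ⟨b - a, ?_⟩
  have h' : (b.1 - a.1) * (c.2 - a.2) = (b.2 - a.2) * (c.1 - a.1) := by
    simp only [orient] at h; linarith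
  rintro x (rfl | rfl | rfl)
  · exact ⟨0, by simp⟩
  · exact ⟨1, by simp⟩
  · by_cases h₁ : b.1 = a.1
    · have h₂ : b.2 - a.2 ≠ 0 := fun h₂ => hab (Prod.ext h₁.symm (sub_eq_zero.1 h₂).symm)
      refine ⟨(x.2 - a.2) / (b.2 - a.2), ?_⟩
      rw [h₁, sub_self, zero_mul] at h'
      have h₃ : x.1 - a.1 = 0 := (mul_eq_zero.1 h'.symm).resolve_left h₂
      ext
      · simp [h₁, sub_eq_zero.1 h₃]
      · simp only [vadd_eq_add, Prod.snd_add, Prod.smul_snd, Prod.snd_sub, smul_eq_mul]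
        field_simp
        ring
    · have h₂ : b.1 - a.1 ≠ 0 := sub_ne_zero.2 h₁
      refine ⟨(x.1 - a.1) / (b.1 - a.1), ?_⟩
      ext
      · simp only [vadd_eq_add, Prod.fst_add, Prod.smul_fst, Prod.fst_sub, smul_eq_mul]
        field_simp
        ring
      · simp only [vadd_eq_add, Prod.snd_add, Prod.smul_snd, Prod.snd_sub, smul_eq_mul]
        field_simp
        linarith

lemma exists_dot_eq (f : Plane →L[ℝ] ℝ) : ∃ g : Plane, ∀ x, f x = dot g x := by
  refine ⟨(f (1, 0), f (0, 1)), fun x => ?_⟩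
  have : x = x.1 • ((1, 0) : Plane) + x.2 • ((0, 1) : Plane) := by ext <;> simp
  conv_lhs => rw [this]
  rw [map_add, map_smul, map_smul, dot, smul_eq_mul, smul_eq_mul, mul_comm, mul_comm x.2]

/-- Crossing edges have a common point. -/
lemma Cross.not_disjoint {a a' b b' : Plane} (h : Cross a a' b b') :
    ¬ Disjoint (segment ℝ a a') (segment ℝ b b') := by
  obtain ⟨h₁, h₂⟩ := h
  rw [Set.not_disjoint_iff]
  set u := orient a a' b
  set v := orient a a' b'
  set x := orient b b' a
  set y := orient b b' a'
  have huv : u - v ≠ 0 := fun h => by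
    rw [← sub_eq_zero.1 h] at h₁; exact absurd h₁ (mul_self_nonneg u).not_gt
  have hxy : x - y ≠ 0 := fun h => by
    rw [← sub_eq_zero.1 h] at h₂; exact absurd h₂ (mul_self_nonneg x).not_gt
  have unit : ∀ {s t : ℝ}, s * t < 0 → 0 ≤ s / (s - t) ∧ s / (s - t) ≤ 1 := by
    intro s t hst
    rcases mul_neg_iff.1 hst with ⟨hs, ht⟩ | ⟨hs, ht⟩
    · exact ⟨div_nonneg hs.le (by linarith), (div_le_one (by linarith)).2 (by linarith)⟩
    · exact ⟨div_nonneg_of_nonpos hs.le (by linarith),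
        (div_le_one_of_neg (by linarith)).2 (by linarith)⟩
  have hrel : x - y = v - u := by simp only [u, v, x, y, orient]; ring
  refine ⟨AffineMap.lineMap a a' (x / (x - y)), ?_, ?_⟩
  · rw [segment_eq_image_lineMap]
    exact ⟨_, unit h₂, rfl⟩
  · rw [segment_eq_image_lineMap]
    refine ⟨u / (u - v), unit h₁, ?_⟩
    have e₁ : u / (u - v) * (u - v) = u := div_mul_cancel₀ _ huv
    have e₂ : x / (x - y) * (x - y) = x := div_mul_cancel₀ _ hxy
    generalize u / (u - v) = s at e₁
    generalize x / (x - y) = t at e₂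
    simp only [AffineMap.lineMap_apply, vsub_eq_sub, vadd_eq_add]
    ext
    · simp only [Prod.fst_add, Prod.smul_fst, Prod.fst_sub, smul_eq_mul]
      apply mul_right_cancel₀ hxy
      have : (s * (b'.1 - b.1) + b.1) * (x - y) =
          - (s * (u - v)) * (b'.1 - b.1) + b.1 * (x - y) := by
        rw [hrel]; ring
      rw [this, e₁]
      have : (t * (a'.1 - a.1) + a.1) * (x - y) = t * (x - y) * (a'.1 - a.1) + a.1 * (x - y) := by
        ring
      rw [this, e₂]
      simp only [u, x, y, orient]; ring
    · simp only [Prod.snd_add, Prod.smul_snd, Prod.snd_sub, smul_eq_mul]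
      apply mul_right_cancel₀ hxy
      have : (s * (b'.2 - b.2) + b.2) * (x - y) =
          - (s * (u - v)) * (b'.2 - b.2) + b.2 * (x - y) := by
        rw [hrel]; ring
      rw [this, e₁]
      have : (t * (a'.2 - a.2) + a.2) * (x - y) = t * (x - y) * (a'.2 - a.2) + a.2 * (x - y) := by
        ring
      rw [this, e₂]
      simp only [u, x, y, orient]; ring

namespace SimplePolygon

variable (P : SimplePolygon)

lemma n_pos : 0 < P.n := lt_of_lt_of_le (by norm_num) P.three_le

lemma corner_add_n (i : ℕ) : P.corner (i + P.n) = P.corner i := by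
  simp [corner]

lemma corner_eq_iff {i j : ℕ} : P.corner i = P.corner j ↔ i ≡ j [MOD P.n] := by
  unfold corner
  refine (P.injective.eq_iff (a := ⟨i % P.n, _⟩) (b := ⟨j % P.n, _⟩)).trans ?_
  simp [Nat.ModEq]

lemma finRotate_mod (i : ℕ) :
    finRotate P.n ⟨i % P.n, Nat.mod_lt _ P.n_pos⟩ = ⟨(i + 1) % P.n, Nat.mod_lt _ P.n_pos⟩ := by
  have : NeZero P.n := ⟨P.n_pos.ne'⟩
  have h3 := P.three_le
  rw [finRotate_apply]
  ext
  rw [Fin.val_add, Fin.val_one', Nat.add_mod_mod, Nat.mod_add_mod]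

lemma edgeSet_eq (i : ℕ) : P.poly.edgeSet ℝ ⟨i % P.n, Nat.mod_lt _ P.n_pos⟩ =
    segment ℝ (P.corner i) (P.corner (i + 1)) := by
  rw [Polygon.edgeSet, finRotate_mod, affineSegment_eq_segment]
  rfl

lemma carrier_eq : P.carrier = ⋃ i, segment ℝ (P.corner i) (P.corner (i + 1)) := by
  ext x
  simp only [carrier, Polygon.boundary, Set.mem_iUnion]
  constructor
  · rintro ⟨i, hi⟩
    refine ⟨i, ?_⟩
    rw [← edgeSet_eq]
    convert hi
    exact Nat.mod_eq_of_lt i.2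
  · rintro ⟨i, hi⟩
    rw [← edgeSet_eq] at hi
    exact ⟨_, hi⟩

lemma corner_mem_carrier (i : ℕ) : P.corner i ∈ P.carrier := by
  rw [carrier_eq]
  exact Set.mem_iUnion.2 ⟨i, left_mem_segment _ _ _⟩

lemma carrier_subset {S : Set Plane} (hS : Convex ℝ S) (h : ∀ i, P.corner i ∈ S) :
    P.carrier ⊆ S := by
  rw [carrier_eq]
  exact Set.iUnion_subset fun i => hS.segment_subset (h i) (h (i + 1))

lemma finite_range_corner : (Set.range P.corner).Finite := by
  refine (Set.finite_range P.poly.vertices).subset ?_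
  rintro _ ⟨i, rfl⟩
  exact ⟨_, rfl⟩

lemma hull_eq : P.hull = convexHull ℝ (Set.range P.corner) := by
  refine subset_antisymm ?_ ?_
  · exact convexHull_min (P.carrier_subset (convex_convexHull _ _) fun i =>
      subset_convexHull _ _ ⟨i, rfl⟩) (convex_convexHull _ _)
  · refine convexHull_mono ?_
    rintro _ ⟨i, rfl⟩
    exact P.corner_mem_carrier i

lemma corner_mem_hull (i : ℕ) : P.corner i ∈ P.hull :=
  subset_convexHull _ _ (P.corner_mem_carrier i)

lemma not_cross {i j : ℕ} (h₁ : ¬ i ≡ j [MOD P.n]) (h₂ : ¬ i + 1 ≡ j [MOD P.n])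
    (h₃ : ¬ j + 1 ≡ i [MOD P.n]) :
    ¬ Cross (P.corner i) (P.corner (i + 1)) (P.corner j) (P.corner (j + 1)) := by
  intro h
  refine h.not_disjoint ?_
  rw [← edgeSet_eq, ← edgeSet_eq]
  refine P.nonadjacent _ _ ?_ ?_ ?_
  · simpa [Nat.ModEq] using h₁
  · rw [finRotate_mod]; simpa [Nat.ModEq] using h₂
  · rw [finRotate_mod]; simpa [Nat.ModEq] using h₃

/-- Disjoint convex hulls are separated by a line. -/
lemma exists_separation {P P' : SimplePolygon} (h : Disjoint P.hull P'.hull) :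
    ∃ (φ : Plane) (c : ℝ), (∀ i, dot φ (P.corner i) < c) ∧ ∀ i, c < dot φ (P'.corner i) := by
  have hc : ∀ R : SimplePolygon, IsCompact R.hull := fun R => by
    rw [hull_eq]; exact R.finite_range_corner.isCompact_convexHull ℝ
  obtain ⟨f, u, v, hu, huv, hv⟩ := geometric_hahn_banach_compact_closed (convex_convexHull ℝ _)
    (hc P) (convex_convexHull ℝ _) (hc P').isClosed h
  obtain ⟨φ, hφ⟩ := exists_dot_eq f
  refine ⟨φ, u, fun i => ?_, fun i => ?_⟩
  · rw [← hφ]; exact hu _ (P.corner_mem_hull i)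
  · rw [← hφ]; exact huv.trans (hv _ (P'.corner_mem_hull i))

/-- A vertex of the convex hull is the unique maximum of a linear functional. -/
lemma exists_dot_lt_of_extreme {i : ℕ} (h : P.corner i ∈ P.hull.extremePoints ℝ) :
    ∃ g : Plane, ∀ j, ¬ j ≡ i [MOD P.n] → dot g (P.corner j) < dot g (P.corner i) := by
  -- Removing an extreme point keeps the hull convex, so the hull of the other corners misses it and
  -- can be separated from it.
  have hconv := (((convex_convexHull ℝ _).mem_extremePoints_iff_convex_sdiff).1 h).2
  set S := Set.range P.corner \ {P.corner i}
  have hS : convexHull ℝ S ⊆ P.hull \ {P.corner i} := by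
    refine convexHull_min ?_ hconv
    rintro _ ⟨⟨j, rfl⟩, hj⟩
    exact ⟨P.corner_mem_hull j, hj⟩
  obtain ⟨f, u, hu, hu'⟩ := geometric_hahn_banach_closed_point (convex_convexHull ℝ S)
    ((P.finite_range_corner.subset Set.sdiff_subset).isCompact_convexHull ℝ).isClosed
    (fun hm => (hS hm).2 rfl)
  obtain ⟨g, hg⟩ := exists_dot_eq f
  refine ⟨g, fun j hj => ?_⟩
  rw [← hg, ← hg]
  refine (hu _ (subset_convexHull _ _ ⟨⟨j, rfl⟩, fun e => hj ?_⟩)).trans hu'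
  exact P.corner_eq_iff.1 e

end SimplePolygon

/-! ### Mirror images -/

/-- The reflection in the vertical axis. -/
def mirror (x : Plane) : Plane := (-x.1, x.2)

lemma orient_mirror (a b c : Plane) :
    orient (mirror a) (mirror b) (mirror c) = -orient a b c := by
  simp only [orient, mirror]; ring

/-- Reflection and exchanging the ends of the line both reverse orientation. Thus the reflected
second polygon, looking back at the first, obeys the same sign convention. -/
lemma orient_mirror_swap (a b c : Plane) :
    orient (mirror b) (mirror a) (mirror c) = orient a b c := by
  rw [orient_mirror, orient_swap_left, neg_neg]

lemma dot_mirror (a b : Plane) : dot (mirror a) (mirror b) = dot a b := by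
  simp only [dot, mirror]; ring

lemma cross_mirror {a a' b b' : Plane} :
    Cross (mirror a) (mirror a') (mirror b) (mirror b') ↔ Cross a a' b b' := by
  simp [Cross, orient_mirror]

lemma SeparatedPath.mirror {p : ℕ → Plane} {n : ℕ} {Q : Set Plane} {φ : Plane} {c : ℝ}
    (C : SeparatedPath p n Q φ c) :
    SeparatedPath (fun i => mirror (p i)) n (mirror '' Q) (mirror φ) c where
  three_le := C.three_le
  periodic i := by simp only [C.periodic]
  generic i j k h₁ h₂ h₃ := by
    rw [orient_mirror, neg_ne_zero]; exact C.generic i j k h₁ h₂ h₃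
  generic_right := by
    rintro _ ⟨q, hq, rfl⟩ i j h
    rw [orient_mirror, neg_ne_zero]
    exact C.generic_right q hq i j h
  not_cross i j h₁ h₂ h₃ := by
    rw [cross_mirror]; exact C.not_cross i j h₁ h₂ h₃
  left i := by rw [dot_mirror]; exact C.left i
  right := by
    rintro _ ⟨q, hq, rfl⟩
    rw [dot_mirror]; exact C.right q hq

/-! ### The height of a line on a separating line -/

/-- The position at which the line through `a` and `b` meets the line on which `dot φ` is `c`. -/
noncomputable def height (φ : Plane) (c : ℝ) (a b : Plane) : ℝ :=
  (dot (perp φ) a * (dot φ b - c) + dot (perp φ) b * (c - dot φ a)) / (dot φ b - dot φ a)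

/-- The second line meets the separating line at a weighted mean of `a'` and `b'`, so its position
relative to the first line is the corresponding mean of their orientations. -/
lemma height_sub {φ a b a' b' : Plane} {c : ℝ} (h : dot φ a < dot φ b)
    (h' : dot φ a' < dot φ b') :
    (height φ c a' b' - height φ c a b) * ((dot φ b' - dot φ a') * (dot φ b - dot φ a)) =
      dot φ φ * ((dot φ b' - c) * orient a b a' + (c - dot φ a') * orient a b b') := by
  have h₁ : dot φ b - dot φ a ≠ 0 := (sub_pos.2 h).ne'
  have h₂ : dot φ b' - dot φ a' ≠ 0 := (sub_pos.2 h').ne'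
  unfold height
  rw [div_sub_div _ _ h₂ h₁, div_mul_cancel₀ _ (mul_ne_zero h₂ h₁)]
  simp only [dot, perp, orient]
  ring

lemma dot_self_pos {φ a b : Plane} (h : dot φ a < dot φ b) : 0 < dot φ φ := by
  have h0 : φ.1 ≠ 0 ∨ φ.2 ≠ 0 := by
    by_contra! hn
    simp [dot, hn.1, hn.2] at h
  unfold dot
  rcases h0 with h0 | h0
  · nlinarith [mul_self_pos.2 h0, mul_self_nonneg φ.2]
  · nlinarith [mul_self_pos.2 h0, mul_self_nonneg φ.1]

lemma height_lt_iff {φ a b a' b' : Plane} {c : ℝ} (h : dot φ a < dot φ b)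
    (h' : dot φ a' < dot φ b') :
    height φ c a b < height φ c a' b' ↔
      0 < (dot φ b' - c) * orient a b a' + (c - dot φ a') * orient a b b' := by
  have e := height_sub (c := c) h h'
  have k := mul_pos (sub_pos.2 h') (sub_pos.2 h)
  rw [← sub_pos, ← mul_pos_iff_of_pos_right k, e, mul_pos_iff_of_pos_left (dot_self_pos h)]

/-! ### The invariant of the search -/

section

variable {P : Fin 2 → SimplePolygon}

lemma GeneralPosition.orient_ne_zero (hP : GeneralPosition P) {a b c : Plane}
    (ha : ∃ k i, (P k).corner i = a) (hb : ∃ k i, (P k).corner i = b)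
    (hc : ∃ k i, (P k).corner i = c) (hab : a ≠ b) (hbc : b ≠ c) (hac : a ≠ c) :
    orient a b c ≠ 0 := fun h =>
  hP.2 a (by simpa using ha) b (by simpa using hb) c (by simpa using hc) hab hbc hac
    (collinear_of_orient_eq_zero hab h)

lemma GeneralPosition.corner_ne (hP : GeneralPosition P) {k l : Fin 2} (hkl : k ≠ l) (i j : ℕ) :
    (P k).corner i ≠ (P l).corner j := by
  have h : ∀ i j, (P 0).corner i ≠ (P 1).corner j := fun i j e =>
    Set.disjoint_left.1 hP.1 ⟨i, rfl⟩ ⟨j, e.symm⟩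
  fin_cases k <;> fin_cases l
  · exact absurd rfl hkl
  · exact h i j
  · exact (h j i).symm
  · exact absurd rfl hkl

lemma GeneralPosition.separatedPath (hP : GeneralPosition P) {k l : Fin 2} (hkl : k ≠ l)
    {φ : Plane} {c : ℝ} (hk : ∀ i, dot φ ((P k).corner i) < c)
    (hl : ∀ i, c < dot φ ((P l).corner i)) :
    SeparatedPath (P k).corner (P k).n (Set.range (P l).corner) φ c where
  three_le := (P k).three_le
  periodic := (P k).corner_add_n
  generic i j m h₁ h₂ h₃ := hP.orient_ne_zero ⟨k, i, rfl⟩ ⟨k, j, rfl⟩ ⟨k, m, rfl⟩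
    (mt (P k).corner_eq_iff.1 h₁) (mt (P k).corner_eq_iff.1 h₂) (mt (P k).corner_eq_iff.1 h₃)
  generic_right := by
    rintro _ ⟨m, rfl⟩ i j h
    exact hP.orient_ne_zero ⟨k, i, rfl⟩ ⟨l, m, rfl⟩ ⟨k, j, rfl⟩ (hP.corner_ne hkl _ _)
      (hP.corner_ne hkl.symm _ _) (mt (P k).corner_eq_iff.1 h)
  not_cross _ _ h₁ h₂ h₃ := (P k).not_cross h₁ h₂ h₃
  left := hk
  right := by rintro _ ⟨m, rfl⟩; exact hl m

/-- The upper outer common tangent. -/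
lemma exists_tangent {φ : Plane} {c : ℝ} (h₀ : ∀ i, dot φ ((P 0).corner i) < c)
    (h₁ : ∀ i, c < dot φ ((P 1).corner i)) :
    ∃ r₀ < (P 0).n, ∃ r₁ < (P 1).n,
      ∀ k i, orient ((P 0).corner r₀) ((P 1).corner r₁) ((P k).corner i) ≤ 0 := by
  obtain ⟨⟨r₀, r₁⟩, hr, hmax⟩ := Finset.exists_max_image
    (Finset.range (P 0).n ×ˢ Finset.range (P 1).n)
    (fun r => height φ c ((P 0).corner r.1) ((P 1).corner r.2))
    ⟨(0, 0), by simp [(P 0).n_pos, (P 1).n_pos]⟩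
  simp only [Finset.mem_product, Finset.mem_range] at hr hmax
  have hlt : ∀ i j, dot φ ((P 0).corner i) < dot φ ((P 1).corner j) := fun i j =>
    (h₀ i).trans (h₁ j)
  have hmod : ∀ (k : Fin 2) (i : ℕ), (P k).corner (i % (P k).n) = (P k).corner i := fun k i =>
    (P k).corner_eq_iff.2 (Nat.mod_modEq _ _)
  refine ⟨r₀, hr.1, r₁, hr.2, fun k i => ?_⟩
  by_contra! hn
  fin_cases k
  · have hm := hmax (i % (P 0).n, r₁) ⟨Nat.mod_lt _ (P 0).n_pos, hr.2⟩
    rw [hmod] at hm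
    refine hm.not_gt ((height_lt_iff (hlt _ _) (hlt _ _)).2 ?_)
    rw [orient_self_right, mul_zero, add_zero]
    exact mul_pos (sub_pos.2 (h₁ _)) hn
  · have hm := hmax (r₀, i % (P 1).n) ⟨hr.1, Nat.mod_lt _ (P 1).n_pos⟩
    rw [hmod] at hm
    refine hm.not_gt ((height_lt_iff (hlt _ _) (hlt _ _)).2 ?_)
    rw [orient_self_left, mul_zero, zero_add]
    exact mul_pos (sub_pos.2 (h₀ _)) hn

lemma dot_perp_sub (a b v : Plane) :
    dot (perp (b - a)) v - dot (perp (b - a)) a = orient a b v := by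
  simp only [dot, perp, orient, Prod.fst_sub, Prod.snd_sub]; ring

lemma dot_perp_sub' (a b v : Plane) :
    dot (perp (b - a)) v - dot (perp (b - a)) b = orient a b v := by
  simp only [dot, perp, orient, Prod.fst_sub, Prod.snd_sub]; ring

/-- An invariant of the search: `J s₀ s₁` holds for the initial indices, is preserved by updates,
bounds the indices, and lets the search finish only at the tangent. -/
theorem exists_search_invariant (hccw : (P 0).IsCounterclockwise) (hcw : (P 1).IsClockwise)
    (hP : GeneralPosition P) (hdisj : Disjoint (P 0).hull (P 1).hull) :
    ∃ r₀ < (P 0).n, ∃ r₁ < (P 1).n, ∃ J : ℕ → ℕ → Prop,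
      J 0 0 ∧
      (∀ s₀ s₁, J s₀ s₁ → s₀ ≤ r₀ + (P 0).n ∧ s₁ ≤ r₁ + (P 1).n) ∧
      (∀ s₀ s₁ t, J s₀ s₁ → s₀ < t →
        (∀ j, s₀ < j → j < t →
          orient ((P 0).corner s₀) ((P 1).corner s₁) ((P 0).corner j) ≤ 0) →
        0 < orient ((P 0).corner s₀) ((P 1).corner s₁) ((P 0).corner t) → J t s₁) ∧
      (∀ s₀ s₁ t, J s₀ s₁ → s₁ < t →
        (∀ j, s₁ < j → j < t →
          orient ((P 0).corner s₀) ((P 1).corner s₁) ((P 1).corner j) ≤ 0) →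
        0 < orient ((P 0).corner s₀) ((P 1).corner s₁) ((P 1).corner t) → J s₀ t) ∧
      (∀ s₀ s₁, orient ((P 0).corner s₀) ((P 1).corner s₁) ((P 0).corner r₀) ≤ 0 →
        orient ((P 0).corner s₀) ((P 1).corner s₁) ((P 1).corner r₁) ≤ 0 →
        ∀ k i, orient ((P 0).corner s₀) ((P 1).corner s₁) ((P k).corner i) ≤ 0) := by
  obtain ⟨φ, c, h₀, h₁⟩ := SimplePolygon.exists_separation hdisj
  have hlt : ∀ i j, dot φ ((P 0).corner i) < dot φ ((P 1).corner j) := fun i j =>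
    (h₀ i).trans (h₁ j)
  obtain ⟨r₀, hr₀, r₁, hr₁, htan⟩ := exists_tangent h₀ h₁
  have C₀ := hP.separatedPath (k := 0) (l := 1) (by simp) h₀ h₁
  have hneg : ∀ x, dot (-φ) x = - dot φ x := fun x => by simp [dot]; ring
  -- The second polygon lies on the other side of the separating line, hence the signs of `φ` and
  -- `c`. Reflection makes its clockwise order counterclockwise.
  have C₁ := (hP.separatedPath (k := 1) (l := 0) (φ := -φ) (c := -c) (by simp)
    (fun i => by rw [hneg]; linarith [h₁ i]) (fun i => by rw [hneg]; linarith [h₀ i])).mirror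
  set g := perp ((P 1).corner r₁ - (P 0).corner r₀)
  have htan₀ : ∀ j, ¬ j ≡ r₀ [MOD (P 0).n] →
      orient ((P 0).corner r₀) ((P 1).corner r₁) ((P 0).corner j) < 0 := fun j hj =>
    lt_of_le_of_ne (htan 0 j) (hP.orient_ne_zero ⟨_, _, rfl⟩ ⟨_, _, rfl⟩ ⟨_, _, rfl⟩
      (hP.corner_ne (by simp) _ _) (hP.corner_ne (by simp) _ _)
      fun e => hj ((P 0).corner_eq_iff.1 e.symm))
  have htan₁ : ∀ j, ¬ j ≡ r₁ [MOD (P 1).n] →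
      orient ((P 0).corner r₀) ((P 1).corner r₁) ((P 1).corner j) < 0 := fun j hj =>
    lt_of_le_of_ne (htan 1 j) (hP.orient_ne_zero ⟨_, _, rfl⟩ ⟨_, _, rfl⟩ ⟨_, _, rfl⟩
      (hP.corner_ne (by simp) _ _) (fun e => hj ((P 1).corner_eq_iff.1 e.symm))
      (hP.corner_ne (by simp) _ _))
  have T₀ : TangentCorner (P 0).corner (P 0).n (Set.range (P 1).corner) g r₀ := by
    have lt : ∀ j, ¬ j ≡ r₀ [MOD (P 0).n] →
        dot g ((P 0).corner j) < dot g ((P 0).corner r₀) := fun j hj => by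
      rw [← sub_neg, dot_perp_sub]; exact htan₀ j hj
    refine ⟨lt, ?_, ?_⟩
    · rintro _ ⟨j, rfl⟩
      rw [← sub_nonpos, dot_perp_sub]; exact htan 1 j
    · obtain ⟨i, hi, hi'⟩ := hccw
      obtain ⟨g', hg'⟩ := (P 0).exists_dot_lt_of_extreme hi
      refine C₀.left_turn ⟨_, 0, rfl⟩ hg' lt ?_
      rw [show i + 1 + (P 0).n - 1 = i + (P 0).n by omega, (P 0).corner_add_n]
      rwa [orientSign_eq, sign_eq_one_iff] at hi'
  have T₁ : TangentCorner (fun i => mirror ((P 1).corner i)) (P 1).n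
      (mirror '' Set.range (P 0).corner) (mirror g) r₁ := by
    have lt : ∀ j, ¬ j ≡ r₁ [MOD (P 1).n] → dot (mirror g) (mirror ((P 1).corner j)) <
        dot (mirror g) (mirror ((P 1).corner r₁)) := fun j hj => by
      rw [dot_mirror, dot_mirror, ← sub_neg, dot_perp_sub']; exact htan₁ j hj
    refine ⟨lt, ?_, ?_⟩
    · rintro _ ⟨_, ⟨j, rfl⟩, rfl⟩
      rw [dot_mirror, dot_mirror, ← sub_nonpos, dot_perp_sub']; exact htan 0 j
    · obtain ⟨i, hi, hi'⟩ := hcw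
      obtain ⟨g', hg'⟩ := (P 1).exists_dot_lt_of_extreme hi
      refine C₁.left_turn ⟨_, _, ⟨0, rfl⟩, rfl⟩ (g := mirror g') (i := i + 1)
        (fun j hj => ?_) lt ?_
      · rw [dot_mirror, dot_mirror]; exact hg' j hj
      rw [show i + 1 + (P 1).n - 1 = i + (P 1).n by omega, (P 1).corner_add_n, orient_mirror]
      rw [orientSign_eq, sign_eq_neg_one_iff] at hi'
      linarith
  -- Each search is measured relative to the current corner of the other polygon: an update of one
  -- index advances one search and turns the line of the other.
  refine ⟨r₀, hr₀, r₁, hr₁, fun s₀ s₁ =>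
    Progress (P 0).corner (P 0).n r₀ ((P 1).corner s₁) s₀ ∧
    Progress (fun i => mirror ((P 1).corner i)) (P 1).n r₁ (mirror ((P 0).corner s₀)) s₁,
    ⟨SeparatedPath.progress_zero _ (P 0).n_pos _, SeparatedPath.progress_zero _ (P 1).n_pos _⟩,
    fun s₀ s₁ h => ⟨SeparatedPath.Progress.le h.1, SeparatedPath.Progress.le h.2⟩, ?_, ?_, ?_⟩
  · intro s₀ s₁ t h ht hrej hpos
    refine ⟨C₀.progress_advance T₀ ⟨s₁, rfl⟩ ht hrej hpos h.1,
      C₁.progress_turn T₁ ⟨_, ⟨s₀, rfl⟩, rfl⟩ ⟨_, ⟨t, rfl⟩, rfl⟩ ?_ h.2⟩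
    rwa [orient_mirror_swap]
  · intro s₀ s₁ t h ht hrej hpos
    refine ⟨C₀.progress_turn T₀ ⟨s₁, rfl⟩ ⟨t, rfl⟩ hpos h.1,
      C₁.progress_advance T₁ ⟨_, ⟨s₀, rfl⟩, rfl⟩ ht (fun j hj hj' => ?_) ?_ h.2⟩
    · rw [orient_mirror_swap]; exact hrej j hj hj'
    · rwa [orient_mirror_swap]
  · intro s₀ s₁ h h' k i
    -- As neither touching corner is left of the current line, the tangent is not higher. The
    -- tangent leaves all other corners strictly on its right, so equality of height forces equality
    -- of corners.
    have hle : ¬ height φ c ((P 0).corner s₀) ((P 1).corner s₁) <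
        height φ c ((P 0).corner r₀) ((P 1).corner r₁) := by
      rw [height_lt_iff (hlt _ _) (hlt _ _), not_lt]
      nlinarith [mul_nonneg (sub_pos.2 (h₁ r₁)).le (neg_nonneg.2 h),
        mul_nonneg (sub_pos.2 (h₀ r₀)).le (neg_nonneg.2 h')]
    have e := height_sub (c := c) (hlt r₀ r₁) (hlt s₀ s₁)
    have hsum : 0 ≤ (dot φ ((P 1).corner s₁) - c) *
          orient ((P 0).corner r₀) ((P 1).corner r₁) ((P 0).corner s₀) +
        (c - dot φ ((P 0).corner s₀)) *
          orient ((P 0).corner r₀) ((P 1).corner r₁) ((P 1).corner s₁) := by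
      by_contra! hn
      have := mul_neg_of_pos_of_neg (dot_self_pos (hlt 0 0)) hn
      rw [← e] at this
      exact absurd this (mul_nonneg (sub_nonneg.2 (not_lt.1 hle)) (mul_pos
        (sub_pos.2 (hlt _ _)) (sub_pos.2 (hlt _ _))).le).not_gt
    have e₀ : (P 0).corner s₀ = (P 0).corner r₀ := by
      rw [SimplePolygon.corner_eq_iff]
      by_contra hn
      nlinarith [mul_pos (sub_pos.2 (h₁ s₁)) (neg_pos.2 (htan₀ s₀ hn)),
        mul_nonneg (sub_pos.2 (h₀ s₀)).le (neg_nonneg.2 (htan 1 s₁))]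
    have e₁ : (P 1).corner s₁ = (P 1).corner r₁ := by
      rw [SimplePolygon.corner_eq_iff]
      by_contra hn
      nlinarith [mul_nonneg (sub_pos.2 (h₁ s₁)).le (neg_nonneg.2 (htan 0 s₀)),
        mul_pos (sub_pos.2 (h₀ s₀)) (neg_pos.2 (htan₁ s₁ hn))]
    rw [e₀, e₁]
    exact htan k i

end

/-! ### Resource bounds -/

/-- The program `c` takes the variables from `σ` to `σ'` within the given bounds on the time, the
number of iterations, the number of bits and the number of reals. -/
def Runs (P : Fin 2 → SimplePolygon) (c : Cmd) (σ σ' : Store) (T I B K : ℕ) : Prop :=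
  ∃ U, Exec P c σ U σ' ∧ U.time ≤ T ∧ U.iterations ≤ I ∧ U.bits ≤ B ∧ U.cells ≤ K

namespace Runs

variable {P : Fin 2 → SimplePolygon} {c d : Cmd} {p : Test} {σ σ' σ'' : Store}
  {T T' I I' B K : ℕ}

lemma mono (h : Runs P c σ σ' T I B K) (hT : T ≤ T') (hI : I ≤ I') : Runs P c σ σ' T' I' B K := by
  obtain ⟨U, hU, h₁, h₂, h₃, h₄⟩ := h
  exact ⟨U, hU, h₁.trans hT, h₂.trans hI, h₃, h₄⟩

lemma skip (hσ : σ.bits ≤ B) : Runs P .skip σ σ 0 0 B K :=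
  ⟨_, .skip σ, le_rfl, le_rfl, hσ, Nat.zero_le _⟩

lemma assign {x : Var} {e : NatExp} (h : σ.bits + e.bits P σ ≤ B)
    (h' : Store.bits (Function.update σ x (e.eval P σ)) ≤ B) :
    Runs P (.assign x e) σ (Function.update σ x (e.eval P σ)) (e.cost + 1) 0 B K :=
  ⟨_, .assign x e σ, le_rfl, le_rfl, max_le h h', Nat.zero_le _⟩

lemma seq (h : Runs P c σ σ' T I B K) (h' : Runs P d σ' σ'' T' I' B K) :
    Runs P (.seq c d) σ σ'' (T + T') (I + I') B K := by
  obtain ⟨U, hU, h₁, h₂, h₃, h₄⟩ := h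
  obtain ⟨V, hV, k₁, k₂, k₃, k₄⟩ := h'
  exact ⟨_, hU.seq hV, add_le_add h₁ k₁, add_le_add h₂ k₂, max_le h₃ k₃, max_le h₄ k₄⟩

lemma ite_true (hp : p.Holds P σ) (hB : σ.bits + p.bits P σ ≤ B) (hK : p.cells ≤ K)
    (h : Runs P c σ σ' T I B K) : Runs P (.ite p c d) σ σ' (p.cost + T) I B K := by
  obtain ⟨U, hU, h₁, h₂, h₃, h₄⟩ := h
  exact ⟨_, hU.ite_true hp, add_le_add le_rfl h₁, (zero_add U.iterations).trans_le h₂,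
    max_le hB h₃, max_le hK h₄⟩

lemma ite_false (hp : ¬ p.Holds P σ) (hB : σ.bits + p.bits P σ ≤ B) (hK : p.cells ≤ K)
    (h : Runs P d σ σ' T I B K) : Runs P (.ite p c d) σ σ' (p.cost + T) I B K := by
  obtain ⟨U, hU, h₁, h₂, h₃, h₄⟩ := h
  exact ⟨_, hU.ite_false hp, add_le_add le_rfl h₁, (zero_add U.iterations).trans_le h₂,
    max_le hB h₃, max_le hK h₄⟩

lemma while_true (hp : p.Holds P σ) (hB : σ.bits + p.bits P σ ≤ B) (hK : p.cells ≤ K)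
    (h : Runs P c σ σ' T I B K) (h' : Runs P (.while p c) σ' σ'' T' I' B K) :
    Runs P (.while p c) σ σ'' (p.cost + (T + T')) (1 + (I + I')) B K := by
  obtain ⟨U, hU, h₁, h₂, h₃, h₄⟩ := h
  obtain ⟨V, hV, k₁, k₂, k₃, k₄⟩ := h'
  exact ⟨_, .while_true hp hU hV, add_le_add le_rfl (add_le_add h₁ k₁),
    add_le_add le_rfl (add_le_add h₂ k₂), max_le (max_le hB (Nat.zero_le _)) (max_le h₃ k₃),
    max_le (max_le hK (Nat.zero_le _)) (max_le h₄ k₄)⟩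

lemma while_false (hp : ¬ p.Holds P σ) (hB : σ.bits + p.bits P σ ≤ B) (hK : p.cells ≤ K) :
    Runs P (.while p c) σ σ p.cost 0 B K :=
  ⟨_, .while_false hp, le_rfl, le_rfl, hB, hK⟩

end Runs

lemma Store.bits_le {σ : Store} {M S : ℕ} (hS : ∀ x ≤ M, Nat.size x ≤ S) (h : ∀ x, σ x ≤ M) :
    σ.bits ≤ 5 * S := by
  have := fun x => hS _ (h x)
  have h₁ := this (.s 0)
  have h₂ := this (.t 0)
  have h₃ := this (.s 1)
  have h₄ := this (.t 1)
  have h₅ := this .u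
  unfold Store.bits
  omega

lemma update_le {σ : Store} {M v : ℕ} {x : Var} (h : ∀ y, σ y ≤ M) (hv : v ≤ M) :
    ∀ y, Function.update σ x v y ≤ M := by
  intro y
  by_cases hy : y = x
  · subst hy; simpa using hv
  · simpa [hy] using h y

/-- The five variables take at most `5 * S` bits, which leaves `35 * S` of the budget for
intermediate values. -/
lemma Runs.assign_le {P : Fin 2 → SimplePolygon} {σ : Store} {x : Var} {e : NatExp}
    {M S b K : ℕ} (hS : ∀ x ≤ M, Nat.size x ≤ S) (h : ∀ x, σ x ≤ M) (he : e.bits P σ ≤ b * S)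
    (hb : b ≤ 35) (hv : e.eval P σ ≤ M) :
    Runs P (.assign x e) σ (Function.update σ x (e.eval P σ)) (e.cost + 1) 0 (40 * S) K := by
  have h₁ := Store.bits_le hS h
  have h₂ := Nat.mul_le_mul_right S hb
  exact .assign (by omega) ((Store.bits_le hS (update_le h hv)).trans (by omega))

section

variable {P : Fin 2 → SimplePolygon} {σ : Store} {M S K : ℕ}

lemma Runs.assign_var (hS : ∀ x ≤ M, Nat.size x ≤ S) (h : ∀ x, σ x ≤ M) (x y : Var) :
    Runs P (.assign x (.var y)) σ (Function.update σ x (σ y)) 2 0 (40 * S) K :=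
  .assign_le hS h (b := 1) (by simpa [NatExp.bits] using hS _ (h y)) (by norm_num) (h y)

lemma Runs.assign_const (hS : ∀ x ≤ M, Nat.size x ≤ S) (h : ∀ x, σ x ≤ M) (x : Var) {c : ℕ}
    (hc : c ≤ M) :
    Runs P (.assign x (.const c)) σ (Function.update σ x c) 2 0 (40 * S) K :=
  .assign_le hS h (b := 1) (by simpa [NatExp.bits] using hS _ hc) (by norm_num) hc

lemma Runs.assign_succ (hS : ∀ x ≤ M, Nat.size x ≤ S) (h : ∀ x, σ x ≤ M) (x : Var) {y : Var}
    (hy : σ y + 1 ≤ M) :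
    Runs P (.assign x (.add (.var y) (.const 1))) σ (Function.update σ x (σ y + 1)) 4 0
      (40 * S) K := by
  refine .assign_le hS h (b := 3) ?_ (by norm_num) hy
  have h₁ := hS 1 (by omega)
  have h₂ := hS _ (h y)
  have h₃ := hS _ hy
  simp only [NatExp.bits, NatExp.eval]
  omega

lemma Runs.assign_one_sub (hS : ∀ x ≤ M, Nat.size x ≤ S) (h : ∀ x, σ x ≤ M) (hM : 1 ≤ M)
    (x y : Var) :
    Runs P (.assign x (.sub (.const 1) (.var y))) σ (Function.update σ x (1 - σ y)) 4 0
      (40 * S) K := by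
  have hy : 1 - σ y ≤ M := (Nat.sub_le _ _).trans hM
  refine .assign_le hS h (b := 3) ?_ (by norm_num) hy
  have h₁ := hS 1 hM
  have h₂ := hS _ (h y)
  have h₃ := hS _ hy
  simp only [NatExp.bits, NatExp.eval]
  omega

end

/-! ### The loop -/

/-- The value of the determinant that the algorithm computes for the corner `i` of polygon `k`. -/
def sideOf (P : Fin 2 → SimplePolygon) (σ : Store) (k : Fin 2) (i : ℕ) : ℝ :=
  orient ((P 0).corner (σ (.s 0))) ((P 1).corner (σ (.s 1))) ((P k).corner i)

/-- The test of the body of the loop. -/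
def bodyTest (k : Fin 2) : Test :=
  .pos (.orient (0, .var (.s 0)) (1, .var (.s 1)) (k, .var (.t k)))

lemma bodyTest_bits {P : Fin 2 → SimplePolygon} {σ : Store} {M S : ℕ}
    (hS : ∀ x ≤ M, Nat.size x ≤ S) (h : ∀ x, σ x ≤ M) (k : Fin 2) (hS₀ : 1 ≤ S) :
    σ.bits + (bodyTest k).bits P σ ≤ 40 * S := by
  have h₁ := Store.bits_le hS h
  have h₂ := fun x => hS _ (h x)
  have h₃ : ∀ x m, Nat.size (σ x % m) ≤ S := fun x m =>
    hS _ ((Nat.mod_le _ _).trans (h x))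
  simp only [bodyTest, RealExp.orient, Test.bits, RealExp.bits, NatExp.bits, NatExp.eval]
  have a₁ := h₂ (.s 0)
  have a₂ := h₂ (.s 1)
  have a₃ := h₂ (.t k)
  have b₁ := h₃ (.s 0) (P 0).n
  have b₂ := h₃ (.s 1) (P 1).n
  have b₃ := h₃ (.t k) (P k).n
  omega

/-- The variables after an iteration that moves the line. -/
def advanceStore (σ : Store) (k : Fin 2) : Store :=
  let σ₁ := Function.update σ (.s k) (σ (.t k))
  let σ₂ := Function.update σ₁ (.t (1 - k)) (σ₁ (.s (1 - k)) + 1)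
  let σ₃ := Function.update σ₂ (.t k) (σ₂ (.t k) + 1)
  Function.update σ₃ .u (1 - σ₃ .u)

/-- The variables after an iteration that keeps the line. -/
def rejectStore (σ : Store) (k : Fin 2) : Store :=
  let σ₁ := Function.update σ (.t k) (σ (.t k) + 1)
  Function.update σ₁ .u (1 - σ₁ .u)

section

variable {P : Fin 2 → SimplePolygon} {σ : Store} {M S : ℕ}

/-- The determinant test makes eight reads of cost 3, seven real operations and a comparison, 32
steps in all. The four assignments cost 14 more. The 15 reals are the eight coordinates and the
seven results. -/
lemma runs_advance (hS : ∀ x ≤ M, Nat.size x ≤ S) (hS₀ : 1 ≤ S) (hM : 1 ≤ M)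
    (h : ∀ x, σ x + 1 ≤ M) (k : Fin 2) (hp : 0 < sideOf P σ k (σ (.t k))) :
    Runs P (outerCommonTangentBody k) σ (advanceStore σ k) 46 0 (40 * S) 15 := by
  have h' : ∀ x, σ x ≤ M := fun x => (Nat.le_succ _).trans (h x)
  have hk : (Var.s (1 - k)) ≠ .s k := by fin_cases k <;> simp
  have hk' : (Var.t k) ≠ .t (1 - k) := by fin_cases k <;> simp
  set σ₁ := Function.update σ (.s k) (σ (.t k)) with hσ₁
  have m₁ : ∀ x, σ₁ x ≤ M := update_le h' (h' (.t k))
  have e₁ : σ₁ (.s (1 - k)) + 1 ≤ M := by simpa [hσ₁, hk] using h (.s (1 - k))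
  set σ₂ := Function.update σ₁ (.t (1 - k)) (σ₁ (.s (1 - k)) + 1) with hσ₂
  have m₂ : ∀ x, σ₂ x ≤ M := update_le m₁ e₁
  have e₂ : σ₂ (.t k) + 1 ≤ M := by simpa [hσ₂, hσ₁, hk'] using h (.t k)
  refine Runs.mono (.seq (.ite_true (p := bodyTest k) hp (bodyTest_bits hS h' k hS₀) ?_
    (.seq (.assign_var hS h' _ _) (.assign_succ hS m₁ _ e₁)))
    (.seq (.assign_succ hS m₂ _ e₂) (.assign_one_sub hS (update_le m₂ e₂) hM _ _))) ?_ ?_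
  · simp [bodyTest, RealExp.orient, Test.cells, RealExp.cells]
  · simp [bodyTest, RealExp.orient, Test.cost, RealExp.cost, NatExp.cost]
  · simp

lemma runs_reject (hS : ∀ x ≤ M, Nat.size x ≤ S) (hS₀ : 1 ≤ S) (hM : 1 ≤ M)
    (h : ∀ x, σ x + 1 ≤ M) (k : Fin 2) (hp : ¬ 0 < sideOf P σ k (σ (.t k))) :
    Runs P (outerCommonTangentBody k) σ (rejectStore σ k) 46 0 (40 * S) 15 := by
  have h' : ∀ x, σ x ≤ M := fun x => (Nat.le_succ _).trans (h x)
  refine Runs.mono (.seq (.ite_false (p := bodyTest k) hp (bodyTest_bits hS h' k hS₀) ?_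
    (.skip ((Store.bits_le hS h').trans (by omega))))
    (.seq (.assign_succ hS h' _ (h _))
      (.assign_one_sub hS (update_le h' (h (.t k))) hM _ _))) ?_ ?_
  · simp [bodyTest, RealExp.orient, Test.cells, RealExp.cells]
  · simp [bodyTest, RealExp.orient, Test.cost, RealExp.cost, NatExp.cost]
  · simp

end

/-- The invariant of the loop after `I` iterations, where `J` is an invariant of the pair of
indices that the search has reached. -/
structure LoopInv (P : Fin 2 → SimplePolygon) (J : ℕ → ℕ → Prop) (σ : Store) (I : ℕ) : Prop where
  u_le : σ .u ≤ 1
  lt : ∀ k, σ (.s k) < σ (.t k)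
  gap₀ : σ .u = 0 → σ (.t 0) + σ (.s 1) ≤ σ (.t 1) + σ (.s 0) ∧
    σ (.t 1) + σ (.s 0) ≤ σ (.t 0) + σ (.s 1) + 1
  gap₁ : σ .u = 1 → σ (.t 1) + σ (.s 0) ≤ σ (.t 0) + σ (.s 1) ∧
    σ (.t 0) + σ (.s 1) ≤ σ (.t 1) + σ (.s 0) + 1
  count : I + 2 ≤ σ (.s 0) + σ (.s 1) + σ (.t 0) + σ (.t 1)
  rejected : ∀ k i, σ (.s k) < i → i < σ (.t k) → sideOf P σ k i ≤ 0
  reached : J (σ (.s 0)) (σ (.s 1))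

section

variable {P : Fin 2 → SimplePolygon} {J : ℕ → ℕ → Prop} {σ : Store} {I : ℕ}

lemma LoopInv.reject (h : LoopInv P J σ I) (k : Fin 2) (hu : σ .u = k.val)
    (hp : ¬ 0 < sideOf P σ k (σ (.t k))) : LoopInv P J (rejectStore σ k) (I + 1) := by
  obtain ⟨h₁, h₂, h₃, h₄, h₅, h₆, h₇⟩ := h
  have a₀ := h₂ 0
  have a₁ := h₂ 1
  have hside : ∀ l i, sideOf P (rejectStore σ k) l i = sideOf P σ l i := fun l i => by
    simp [sideOf, rejectStore]
  have hrej : ∀ l i, σ (.s l) < i → i < (rejectStore σ k) (.t l) → sideOf P σ l i ≤ 0 := by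
    intro l i hi hi'
    by_cases hl : l = k
    · subst hl
      have hi' : i < σ (.t l) + 1 := by simpa [rejectStore] using hi'
      rcases (Nat.lt_succ_iff.1 hi').eq_or_lt with rfl | hi'
      · exact not_lt.1 hp
      · exact h₆ l i hi hi'
    · exact h₆ l i hi (by simpa [rejectStore, hl] using hi')
  fin_cases k
  · have g := h₃ (by simpa using hu)
    refine ⟨?_, fun l => ?_, ?_, ?_, ?_, fun l i hi hi' => ?_, ?_⟩
    · simp [rejectStore]
    · fin_cases l <;> simp [rejectStore] <;> omega
    · intro hu'; simp [rejectStore] at hu' hu; omega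
    · intro _; simp [rejectStore]; omega
    · simp [rejectStore]; omega
    · rw [hside]; exact hrej l i (by simpa [rejectStore] using hi) hi'
    · simpa [rejectStore] using h₇
  · have g := h₄ (by simpa using hu)
    refine ⟨?_, fun l => ?_, ?_, ?_, ?_, fun l i hi hi' => ?_, ?_⟩
    · simp [rejectStore]
    · fin_cases l <;> simp [rejectStore] <;> omega
    · intro _; simp [rejectStore]; omega
    · intro hu'; simp [rejectStore] at hu' hu; omega
    · simp [rejectStore]; omega
    · rw [hside]; exact hrej l i (by simpa [rejectStore] using hi) hi'
    · simpa [rejectStore] using h₇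

/-- When the line moves, earlier rejections become worthless; resetting the other `t` empties both
scanned ranges. With `d = t - s`, the sum of the variables changes by `d k - d (1 - k) + 2`, which
is at least 1 because the gap condition gives `d (1 - k) ≤ d k + 1`. -/
lemma LoopInv.advance (h : LoopInv P J σ I) (k : Fin 2) (hu : σ .u = k.val)
    (hJ : J (advanceStore σ k (.s 0)) (advanceStore σ k (.s 1))) :
    LoopInv P J (advanceStore σ k) (I + 1) := by
  obtain ⟨h₁, h₂, h₃, h₄, h₅, h₆, h₇⟩ := h
  have a₀ := h₂ 0
  have a₁ := h₂ 1
  fin_cases k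
  · have g := h₃ (by simpa using hu)
    refine ⟨?_, fun l => ?_, ?_, ?_, ?_, fun l i hi hi' => ?_, hJ⟩
    · simp [advanceStore]
    · fin_cases l <;> simp [advanceStore]
    · intro hu'; simp [advanceStore] at hu' hu; omega
    · intro _; simp [advanceStore]; omega
    · simp [advanceStore]; omega
    · exfalso
      fin_cases l <;> simp [advanceStore] at hi hi' <;> omega
  · have g := h₄ (by simpa using hu)
    refine ⟨?_, fun l => ?_, ?_, ?_, ?_, fun l i hi hi' => ?_, hJ⟩
    · simp [advanceStore]
    · fin_cases l <;> simp [advanceStore]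
    · intro _; simp [advanceStore]; omega
    · intro hu'; simp [advanceStore] at hu' hu; omega
    · simp [advanceStore]; omega
    · exfalso
      fin_cases l <;> simp [advanceStore] at hi hi' <;> omega

end

/-- The condition of the loop. -/
def loopTest : Test :=
  .or (.lt (.var (.t 0)) (.mul (.const 2) (.size 0)))
    (.lt (.var (.t 1)) (.mul (.const 2) (.size 1)))

/-- The body of the loop. -/
def loopBody : Cmd :=
  .ite (.eq (.var .u) (.const 0)) (outerCommonTangentBody 0) (outerCommonTangentBody 1)

section

variable {P : Fin 2 → SimplePolygon} {J : ℕ → ℕ → Prop} {σ : Store} {I M S : ℕ}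

lemma loopTest_holds : loopTest.Holds P σ ↔
    σ (.t 0) < 2 * (P 0).n ∨ σ (.t 1) < 2 * (P 1).n := Iff.rfl

lemma loopTest_bits (hS : ∀ x ≤ M, Nat.size x ≤ S) (h : ∀ x, σ x ≤ M) (hS₀ : 1 ≤ S)
    (hM : 2 * ((P 0).n + (P 1).n) ≤ M) : σ.bits + loopTest.bits P σ ≤ 40 * S := by
  have h₀ := (P 0).n_pos
  have h₁ := Store.bits_le hS h
  have h₂ := hS _ (h (.t 0))
  have h₃ := hS _ (h (.t 1))
  have h₄ := hS 2 (by omega)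
  have h₅ := hS (P 0).n (by omega)
  have h₆ := hS (P 1).n (by omega)
  have h₇ := hS (2 * (P 0).n) (by omega)
  have h₈ := hS (2 * (P 1).n) (by omega)
  simp only [loopTest, Test.bits, NatExp.bits, NatExp.eval]
  omega

lemma advanceStore_le (hM : 1 ≤ M) (h : ∀ x, σ x + 1 ≤ M) (k : Fin 2) :
    ∀ x, advanceStore σ k x ≤ M := by
  have h' : ∀ x, σ x ≤ M := fun x => (Nat.le_succ _).trans (h x)
  have hk : (Var.s (1 - k)) ≠ .s k := by fin_cases k <;> simp
  have hk' : (Var.t k) ≠ .t (1 - k) := by fin_cases k <;> simp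
  refine update_le (update_le (update_le (update_le h' (h' _)) ?_) ?_) ((Nat.sub_le _ _).trans hM)
  · simpa [hk] using h _
  · simpa [hk'] using h _

lemma rejectStore_le (hM : 1 ≤ M) (h : ∀ x, σ x + 1 ≤ M) (k : Fin 2) :
    ∀ x, rejectStore σ k x ≤ M :=
  update_le (update_le (fun x => (Nat.le_succ _).trans (h x)) (h _)) ((Nat.sub_le _ _).trans hM)

/-- If `t k` is below `2 n k`, the gap condition bounds `s k + t (1 - k)` by `t k + s (1 - k) + 1`.
So the sum that dominates the iteration count is at most twice `t k + s (1 - k)` plus 1. -/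
lemma LoopInv.bounds (h : LoopInv P J σ I)
    (hJ : ∀ s₀ s₁, J s₀ s₁ → s₀ < 2 * (P 0).n ∧ s₁ < 2 * (P 1).n) (ht : loopTest.Holds P σ) :
    I < 4 * ((P 0).n + (P 1).n) ∧ ∀ x, σ x ≤ 2 * ((P 0).n + (P 1).n) := by
  obtain ⟨h₁, h₂, h₃, h₄, h₅, h₆, h₇⟩ := h
  have a₀ := h₂ 0
  have a₁ := h₂ 1
  have b := hJ _ _ h₇
  rw [loopTest_holds] at ht
  have hu : σ .u = 0 ∨ σ .u = 1 := by omega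
  have key : I < 4 * ((P 0).n + (P 1).n) ∧ σ (.t 0) ≤ 2 * ((P 0).n + (P 1).n) ∧
      σ (.t 1) ≤ 2 * ((P 0).n + (P 1).n) := by
    rcases hu with hu | hu
    · have := h₃ hu; omega
    · have := h₄ hu; omega
  refine ⟨key.1, fun x => ?_⟩
  rcases x with k | k | _
  · fin_cases k <;> simp <;> omega
  · fin_cases k <;> simp <;> omega
  · omega

lemma LoopInv.runs_body (h : LoopInv P J σ I)
    (h₀ : ∀ s₀ s₁ t, J s₀ s₁ → s₀ < t →
      (∀ j, s₀ < j → j < t →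
        orient ((P 0).corner s₀) ((P 1).corner s₁) ((P 0).corner j) ≤ 0) →
      0 < orient ((P 0).corner s₀) ((P 1).corner s₁) ((P 0).corner t) → J t s₁)
    (h₁ : ∀ s₀ s₁ t, J s₀ s₁ → s₁ < t →
      (∀ j, s₁ < j → j < t →
        orient ((P 0).corner s₀) ((P 1).corner s₁) ((P 1).corner j) ≤ 0) →
      0 < orient ((P 0).corner s₀) ((P 1).corner s₁) ((P 1).corner t) → J s₀ t)
    (hS : ∀ x ≤ M, Nat.size x ≤ S) (hS₀ : 1 ≤ S) (hM : 1 ≤ M) (hσ : ∀ x, σ x + 1 ≤ M) :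
    ∃ σ', Runs P loopBody σ σ' 49 0 (40 * S) 15 ∧ LoopInv P J σ' (I + 1) ∧ ∀ x, σ' x ≤ M := by
  have hσ' : ∀ x, σ x ≤ M := fun x => (Nat.le_succ _).trans (hσ x)
  have hbits : σ.bits + (Test.eq (.var .u) (.const 0)).bits P σ ≤ 40 * S := by
    have a := Store.bits_le hS hσ'
    have b := hS _ (hσ' .u)
    have c := hS 0 (Nat.zero_le _)
    simp only [Test.bits, NatExp.bits]
    omega
  have body : ∀ k : Fin 2, σ .u = k.val → ∃ σ',
      Runs P (outerCommonTangentBody k) σ σ' 46 0 (40 * S) 15 ∧ LoopInv P J σ' (I + 1) ∧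
        ∀ x, σ' x ≤ M := by
    intro k hk
    by_cases hp : 0 < sideOf P σ k (σ (.t k))
    · refine ⟨_, runs_advance hS hS₀ hM hσ k hp, h.advance k hk ?_, advanceStore_le hM hσ k⟩
      fin_cases k
      · simpa [advanceStore] using h₀ _ _ _ h.reached (h.lt 0) (h.rejected 0) hp
      · simpa [advanceStore] using h₁ _ _ _ h.reached (h.lt 1) (h.rejected 1) hp
    · exact ⟨_, runs_reject hS hS₀ hM hσ k hp, h.reject k hk hp, rejectStore_le hM hσ k⟩
  have hu : σ .u = 0 ∨ σ .u = 1 := by have := h.u_le; omega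
  rcases hu with hu | hu
  · obtain ⟨σ', hr, hi, hm⟩ := body 0 hu
    exact ⟨σ', .ite_true (p := .eq (.var .u) (.const 0)) hu hbits (Nat.zero_le _) hr, hi, hm⟩
  · obtain ⟨σ', hr, hi, hm⟩ := body 1 hu
    refine ⟨σ', .ite_false ?_ hbits (Nat.zero_le _) hr, hi, hm⟩
    change ¬ σ .u = 0
    omega

lemma LoopInv.runs_loop
    (hJ : ∀ s₀ s₁, J s₀ s₁ → s₀ < 2 * (P 0).n ∧ s₁ < 2 * (P 1).n)
    (h₀ : ∀ s₀ s₁ t, J s₀ s₁ → s₀ < t →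
      (∀ j, s₀ < j → j < t →
        orient ((P 0).corner s₀) ((P 1).corner s₁) ((P 0).corner j) ≤ 0) →
      0 < orient ((P 0).corner s₀) ((P 1).corner s₁) ((P 0).corner t) → J t s₁)
    (h₁ : ∀ s₀ s₁ t, J s₀ s₁ → s₁ < t →
      (∀ j, s₁ < j → j < t →
        orient ((P 0).corner s₀) ((P 1).corner s₁) ((P 1).corner j) ≤ 0) →
      0 < orient ((P 0).corner s₀) ((P 1).corner s₁) ((P 1).corner t) → J s₀ t)
    (hS : ∀ x ≤ 2 * ((P 0).n + (P 1).n) + 1, Nat.size x ≤ S) (hS₀ : 1 ≤ S) (m : ℕ)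
    (h : LoopInv P J σ I) (hσ : ∀ x, σ x ≤ 2 * ((P 0).n + (P 1).n) + 1)
    (hI : I + m = 4 * ((P 0).n + (P 1).n)) :
    ∃ σ' I', Runs P (.while loopTest loopBody) σ σ' (60 * m + 11) m (40 * S) 15 ∧
      LoopInv P J σ' I' ∧ ¬ loopTest.Holds P σ' := by
  induction m generalizing σ I with
  | zero =>
    have ht : ¬ loopTest.Holds P σ := fun ht => by have := (h.bounds hJ ht).1; omega
    refine ⟨σ, I, ?_, h, ht⟩
    exact .while_false ht (loopTest_bits hS hσ hS₀ (by omega)) (Nat.zero_le _)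
  | succ m ih =>
    have hbits := loopTest_bits (P := P) hS hσ hS₀ (by omega)
    by_cases ht : loopTest.Holds P σ
    · have hb := (h.bounds hJ ht).2
      -- While the test holds, all values are at most `2 N`, where `N` is the total number of
      -- corners, so one iteration stays within `2 N + 1`. Its cost is 11 for the loop test and 49
      -- for the body.
      obtain ⟨σ', hr, hi, hm⟩ := h.runs_body h₀ h₁ hS hS₀ (by omega)
        (fun x => Nat.succ_le_succ (hb x))
      obtain ⟨σ'', I', hr', hi', ht'⟩ := ih hi hm (by omega)
      refine ⟨σ'', I', (Runs.while_true ht hbits (Nat.zero_le _) hr hr').mono ?_ ?_, hi', ht'⟩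
      · simp only [loopTest, Test.cost, NatExp.cost]; omega
      · omega
    · refine ⟨σ, I, (Runs.while_false ht hbits (Nat.zero_le _)).mono ?_ ?_, h, ht⟩
      · simp only [loopTest, Test.cost, NatExp.cost]; omega
      · omega

end

/-- The variables after the initialization. -/
def initialStore : Store :=
  Function.update (Function.update (Function.update (Function.update (Function.update (fun _ => 0)
    (.s 0) 0) (.t 0) 1) (.s 1) 0) (.t 1) 1) .u 0

lemma LoopInv.initial {P : Fin 2 → SimplePolygon} {J : ℕ → ℕ → Prop} (hJ : J 0 0) :
    LoopInv P J initialStore 0 where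
  u_le := Nat.zero_le _
  lt k := by fin_cases k <;> exact Nat.zero_lt_one
  gap₀ _ := ⟨le_rfl, Nat.le_succ _⟩
  gap₁ h := absurd h Nat.zero_ne_one
  count := le_rfl
  rejected k i hi hi' := by
    exfalso
    have h : ∀ k, initialStore (.t k) = initialStore (.s k) + 1 := fun k => by
      fin_cases k <;> rfl
    rw [h] at hi'
    omega
  reached := hJ

/-! ### From the final state to the tangent -/

lemma convex_RHP (a b : Plane) : Convex ℝ (RHP a b) := by
  intro x hx y hy u v hu hv huv
  rw [mem_RHP_iff] at hx hy ⊢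
  have : orient a b (u • x + v • y) = u * orient a b x + v * orient a b y := by
    obtain rfl : v = 1 - u := by linarith
    simp only [orient, Prod.fst_add, Prod.snd_add, Prod.smul_fst, Prod.smul_snd, smul_eq_mul]
    ring
  rw [this]
  nlinarith [mul_nonneg hu (neg_nonneg.2 hx), mul_nonneg hv (neg_nonneg.2 hy)]

lemma isOuterCommonTangent_of_subset {a b : Plane} {S T : Set Plane} (hab : a ≠ b) (ha : a ∈ S)
    (hb : b ∈ T) (hS : S ⊆ RHP a b) (hT : T ⊆ RHP a b) :
    IsOuterCommonTangent line[ℝ, a, b] S T := by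
  have e : line[ℝ, a, b] = line[ℝ, b, a] := by rw [Set.pair_comm]
  exact ⟨⟨⟨a, left_mem_affineSpan_pair ℝ a b, ha⟩, b, a, hab.symm, e, hS⟩,
    ⟨⟨b, right_mem_affineSpan_pair ℝ a b, hb⟩, b, a, hab.symm, e, hT⟩,
    b, a, hab.symm, e, hS, hT⟩

theorem theorem2 :
    ∃ C : ℕ, ∀ P : Fin 2 → SimplePolygon,
      (P 0).IsCounterclockwise → (P 1).IsClockwise → GeneralPosition P →
      Disjoint (P 0).hull (P 1).hull →
      ∃ (U : Usage) (σ : Store),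
        Exec P outerCommonTangent (fun _ => 0) U σ ∧
        IsOuterCommonTangent line[ℝ, (P 0).corner (σ (.s 0)), (P 1).corner (σ (.s 1))]
          (P 0).carrier (P 1).carrier ∧
        (∀ k, (P k).carrier ⊆ RHP ((P 0).corner (σ (.s 0))) ((P 1).corner (σ (.s 1)))) ∧
        U.iterations ≤ 4 * ((P 0).n + (P 1).n) ∧
        U.time ≤ C * ((P 0).n + (P 1).n) ∧
        U.bits ≤ C * Nat.log 2 ((P 0).n + (P 1).n) ∧
        U.cells ≤ C := by
  -- The time is at most `240 * N + 21` and the space at most `40 * (l + 3)` bits, with `N ≥ 6` and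
  -- `l ≥ 2`.
  refine ⟨300, fun P hccw hcw hP hdisj => ?_⟩
  obtain ⟨r₀, hr₀, r₁, hr₁, J, hJ₀, hJ, hadv₀, hadv₁, hfin⟩ :=
    exists_search_invariant hccw hcw hP hdisj
  have hn₀ := (P 0).three_le
  have hn₁ := (P 1).three_le
  set N := (P 0).n + (P 1).n with hN
  set l := Nat.log 2 N with hl
  have hl2 : 2 ≤ l := Nat.le_log_of_pow_le (by norm_num) (by omega)
  have hS : ∀ x ≤ 2 * N + 1, Nat.size x ≤ l + 3 := by
    intro x hx
    have : N < 2 ^ (l + 1) := Nat.lt_pow_succ_log_self (by norm_num) N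
    rw [Nat.size_le, show l + 3 = (l + 1) + 2 from rfl, pow_add]
    omega
  have z : ∀ x, (fun _ => 0 : Store) x ≤ 2 * N + 1 := fun _ => Nat.zero_le _
  have one_le : 1 ≤ 2 * N + 1 := by omega
  have m₁ := update_le (x := .s 0) z (Nat.zero_le _)
  have m₂ := update_le (x := .t 0) m₁ one_le
  have m₃ := update_le (x := .s 1) m₂ (Nat.zero_le _)
  have m₄ := update_le (x := .t 1) m₃ one_le
  have m₅ := update_le (x := .u) m₄ (Nat.zero_le _)
  obtain ⟨σ, I, hrun, hinv, hend⟩ := (LoopInv.initial hJ₀).runs_loop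
    (fun s₀ s₁ h => by have := hJ s₀ s₁ h; omega) hadv₀ hadv₁ hS (by omega) (4 * N) m₅ (by omega)
  obtain ⟨U, hU, hT, hit, hB, hK⟩ := Runs.seq (.assign_const hS z _ (Nat.zero_le _))
    (.seq (.assign_const hS m₁ _ one_le) (.seq (.assign_const hS m₂ _ (Nat.zero_le _))
    (.seq (.assign_const hS m₃ _ one_le) (.seq (.assign_const hS m₄ _ (Nat.zero_le _)) hrun))))
  rw [loopTest_holds, not_or, not_lt, not_lt] at hend
  have hle := hJ _ _ hinv.reached
  have hside : ∀ k i, sideOf P σ k i ≤ 0 := by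
    refine hfin _ _ ?_ ?_
    -- The second copy `r₀ + n₀` of the touching corner is at least `s 0` and below `2 n₀ ≤ t 0`. So
    -- it is either `s 0` itself or a rejected corner.
    · rw [← (P 0).corner_add_n r₀]
      rcases hle.1.eq_or_lt with h | h
      · rw [← h]; simp
      · exact hinv.rejected 0 _ h (by omega)
    · rw [← (P 1).corner_add_n r₁]
      rcases hle.2.eq_or_lt with h | h
      · rw [← h]; simp
      · exact hinv.rejected 1 _ h (by omega)
  have hsub : ∀ k, (P k).carrier ⊆
      RHP ((P 0).corner (σ (.s 0))) ((P 1).corner (σ (.s 1))) := fun k =>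
    (P k).carrier_subset (convex_RHP _ _) fun i => mem_RHP_iff.2 (hside k i)
  refine ⟨U, σ, hU, isOuterCommonTangent_of_subset (hP.corner_ne (by simp) _ _)
    ((P 0).corner_mem_carrier _) ((P 1).corner_mem_carrier _) (hsub 0) (hsub 1), hsub, ?_, ?_, ?_,
    hK.trans (by norm_num)⟩
  · omega
  · omega
  · omega
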